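/- Let $N\ge 1$, $\gamma>1$, $\gamma'=\frac{\gamma}{\gamma-1}$, $0<\alpha<N$ with $N-\gamma'<\alpha$, and $M>0$. For constants $C_V,b>0$ let $V:\mathbb{R}^N\to\mathbb{R}$ be locally Hölder continuous with $$C_V^{-1}(\max\{|x|-C_V,0\})^b\le V(x)\le C_V(1+|x|)^b\qquad\text{for all }x\in\mathbb{R}^N.$$ For $\varepsilon>0$ let $\mathcal{K}_{\varepsilon,M}$ be the set of pairs $(m,w)\in (L^1(\mathbb{R}^N)\cap L^q(\mathbb{R}^N))\times L^1(\mathbb{R}^N;\mathbb{R}^N)$ such that $\int_{\mathbb{R}^N} m\,dx=M$, $m\ge 0$ a.e., and $$\varepsilon\int_{\mathbb{R}^N}m(-\Delta\varphi)\,dx=\int_{\mathbb{R}^N}w\cdot\nabla\varphi\,dx\qquad\text{for all }\varphi\in C_0^\infty(\mathbb{R}^N),$$ where $q=\frac{N}{N-\gamma'+1}$ if $\gamma'<N$ and $q=\gamma'$ if $\gamma'\ge N$. On $\mathcal{K}_{\varepsilon,M}$ define the energy $$\mathcal{E}(m,w)=\int_{\mathbb{R}^N}\Big(mL\Big(-\frac{w}{m}\Big)+V(x)\,m\Big)dx-\frac12\int_{\mathbb{R}^N}\int_{\mathbb{R}^N}\frac{m(x)\,m(y)}{|x-y|^{N-\alpha}}\,dx\,dy,$$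 where $mL(-\frac wm)$ stands for $\frac{m}{\gamma'}\left|\frac wm\right|^{\gamma'}$ if $m>0$, for $0$ if $m=0$ and $w=0$, and for $+\infty$ otherwise, and where $\mathcal{E}(m,w)=+\infty$ whenever the first integral is $+\infty$. Let $$e_\varepsilon(M)=\inf_{(m,w)\in\mathcal{K}_{\varepsilon,M}}\mathcal{E}(m,w).$$ Then there exist positive constants $C_1,C_2$ depending only on $N,\gamma,\alpha,M$, and a positive constant $K$ depending only on $M,C_V,b,N,\alpha,\gamma$, such that for every such $V$ and every $\varepsilon\in(0,1]$ $$-C_1\,\varepsilon^{-\frac{\gamma'(N-\alpha)}{\gamma'-N+\alpha}}\le e_\varepsilon(M)\le -C_2\,\varepsilon^{-\frac{\gamma'(N-\alpha)}{\gamma'-N+\alpha}}+K.$$ -/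

import Mathlib

open MeasureTheory
open scoped ENNReal NNReal Topology ContDiff

namespace MFG

noncomputable section

/-- Euclidean space `ℝ^N` with its Euclidean norm and Lebesgue measure. -/
abbrev Space (N : ℕ) : Type := EuclideanSpace ℝ (Fin N)

/-- The exponent `q`: `N / (N - γ' + 1)` if `γ' < N`, and `γ'` if `γ' ≥ N`
(here `g` stands for `γ'`). -/
def qExp (N : ℕ) (g : ℝ) : ℝ :=
  if g < N then (N : ℝ) / ((N : ℝ) - g + 1) else g

/-- The set of pairs `(m, w)` with `m ∈ L¹ ∩ L^q`, `w ∈ L¹`, `∫ m = M`, `m ≥ 0` a.e. and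
`ε ∫ m (-Δφ) = ∫ w · ∇φ` for all smooth compactly supported `φ` (`g` stands for `γ'`). -/
def constraintSet (N : ℕ) (g ε M : ℝ) : Set ((Space N → ℝ) × (Space N → Space N)) :=
  {p | MemLp p.1 1 volume ∧ MemLp p.1 (ENNReal.ofReal (qExp N g)) volume ∧
    MemLp p.2 1 volume ∧
    ∫ x, p.1 x = M ∧ (∀ᵐ x, 0 ≤ p.1 x) ∧
    ∀ φ : Space N → ℝ, ContDiff ℝ ∞ φ → HasCompactSupport φ →
      ε * ∫ x, p.1 x * (-(Laplacian.laplacian φ x)) = ∫ x, inner ℝ (p.2 x) (gradient φ x)}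

/-- The pointwise value `m L(-w/m)`: it is `m (1/γ') |w/m|^γ'` if `m > 0`, it is `0` if `m = 0`
and `w = 0`, and `+∞` otherwise (`g` stands for `γ'`). -/
def kineticDensity {N : ℕ} (g : ℝ) (m : ℝ) (w : Space N) : ℝ≥0∞ :=
  open scoped Classical in
  if 0 < m then ENNReal.ofReal (m * ((1 / g) * ‖m⁻¹ • w‖ ^ g))
  else if m = 0 ∧ w = 0 then 0
  else ⊤

/-- The nonnegative part `∫ m L(-w/m) + V m dx` of the energy, with values in `[0, ∞]`. -/
def positivePart {N : ℕ} (g : ℝ) (V : Space N → ℝ) (m : Space N → ℝ) (w : Space N → Space N) :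
    ℝ≥0∞ :=
  ∫⁻ x, (kineticDensity g (m x) (w x) + ENNReal.ofReal (V x * m x))

/-- The Riesz interaction `∫∫ m(x) m(y) / |x - y|^(N - α) dx dy`, with values in `[0, ∞]`. -/
def rieszInteraction {N : ℕ} (α : ℝ) (m : Space N → ℝ) : ℝ≥0∞ :=
  ∫⁻ x, ∫⁻ y, ENNReal.ofReal (m x * m y / ‖x - y‖ ^ ((N : ℝ) - α))

open scoped Classical in
/-- The energy: `∫ m L(-w/m) + V m dx` minus one half of the Riesz interaction on the
constraint set, and `+∞` off it. It is also `+∞` as soon as the first integral is infinite, so that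
no expression `∞ - ∞` occurs (in `EReal` that difference would be `-∞`). -/
def energy {N : ℕ} (g α ε M : ℝ) (V : Space N → ℝ) (m : Space N → ℝ) (w : Space N → Space N) :
    EReal :=
  if (m, w) ∈ constraintSet N g ε M then
    if positivePart g V m w = ⊤ then ⊤
    else (positivePart g V m w : EReal) - ((rieszInteraction α m / 2 : ℝ≥0∞) : EReal)
  else ⊤

/-- The infimum `e_ε(M)` of the energy over the constraint set. -/
def infEnergy {N : ℕ} (g α ε M : ℝ) (V : Space N → ℝ) : EReal :=
  ⨅ p ∈ constraintSet N g ε M, energy g α ε M V p.1 p.2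

/-- Local Hölder continuity: every point has a neighbourhood on which the function is Hölder
continuous with some exponent in `(0, 1]`. -/
def LocallyHolder {N : ℕ} (V : Space N → ℝ) : Prop :=
  ∀ x, ∃ U ∈ 𝓝 x, ∃ C θ : ℝ≥0, 0 < θ ∧ θ ≤ 1 ∧ HolderOnWith C θ V U

/-- The growth condition `C_V⁻¹ (max (|x| - C_V) 0)^b ≤ V x ≤ C_V (1 + |x|)^b`. -/
def PotentialGrowth {N : ℕ} (CV b : ℝ) (V : Space N → ℝ) : Prop :=
  ∀ x, CV⁻¹ * (max (‖x‖ - CV) 0) ^ b ≤ V x ∧ V x ≤ CV * (1 + ‖x‖) ^ b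

end

end MFG

/-! Write g = γ' and a = N - α, so that 0 < a < g. The scale of the answer is S = ε^(-ga/(g-a)),
where kinetic energy and interaction balance.

Lower bound: no regularity of m is needed, because the weak equation is used by duality. For each y
it is tested with a potential Φ centred at y whose Laplacian controls the kernel |x - y|^(-a). If |x
- y|^(-a) + (B/ε) l |∇Φ| ≤ B ΔΦ + θ l^g + C S for all l ≥ 0, then taking l = |w|/m, multiplying by m
and integrating removes Φ altogether, since ε∫ m ΔΦ + ∫ w·∇Φ = 0. What remains bounds the Riesz
potential of m at y by θ g P + C S M, uniformly in y, where P is the kinetic energy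
(`exists_rieszPotential_bound`). Integrating against m(y), with θ chosen so that half the
interaction costs at most P, leaves a multiple of -S.

The pointwise inequality is Young's inequality applied to the field (x - y)|x - y|^(-a), regularised
at scale δ, with δ → 0 by Fatou. For a < 1 this field grows at infinity and is damped beyond
distance ε^(g/(g-a)), where the kernel is at most S.

Upper bound: the competitor is a smooth bump m of width 1/τ with flux ε∇m. Its kinetic energy is at
most A(ετ)^g and its interaction at least a constant times τ^a. Both are of order S for τ = κ
ε^(-g/(g-a)), and a suitable κ makes the interaction win. The support stays in a fixed ball for ε ≤
1, so V costs only a constant. -/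

namespace MFG

/-! ### Gradient and Laplacian calculus, radial potentials -/

theorem contDiff_gradient {N : ℕ} {f : Space N → ℝ} (hf : ContDiff ℝ ∞ f) :
    ContDiff ℝ ∞ (gradient f) :=
  (InnerProductSpace.toDual ℝ (Space N)).symm.toContinuousLinearEquiv.contDiff.comp
    (hf.fderiv_right (m := ∞) (by simp))

theorem hasGradientAt_of_contDiff {N : ℕ} {f : Space N → ℝ} (hf : ContDiff ℝ ∞ f) (x : Space N) :
    HasGradientAt f (gradient f x) x :=
  (hf.differentiable (by simp) x).hasGradientAt

/-- The Laplacian is the trace of the derivative of the gradient field. -/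
theorem laplacian_eq_of_hasGradientAt {N : ℕ} {f : Space N → ℝ} {X : Space N → Space N}
    {A : Space N →L[ℝ] Space N} {x : Space N} (hX : ∀ x, HasGradientAt f (X x) x)
    (hA : HasFDerivAt X A x) :
    Laplacian.laplacian f x = ∑ i, (A (EuclideanSpace.single i 1)) i := by
  rw [InnerProductSpace.laplacian_eq_iteratedFDeriv_orthonormalBasis f
    (EuclideanSpace.basisFun (Fin N) ℝ)]
  refine Finset.sum_congr rfl fun i _ => ?_
  have h1 : fderiv ℝ f = fun x => InnerProductSpace.toDual ℝ (Space N) (X x) := by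
    funext x
    exact (hX x).hasFDerivAt.fderiv
  have h2 : HasFDerivAt (fderiv ℝ f)
      ((InnerProductSpace.toDual ℝ (Space N)).toContinuousLinearEquiv.toContinuousLinearMap ∘L A)
      x := by
    rw [h1]
    exact (InnerProductSpace.toDual ℝ
      (Space N)).toContinuousLinearEquiv.toContinuousLinearMap.hasFDerivAt.comp x hA
  rw [iteratedFDeriv_two_apply, h2.fderiv]
  simp [EuclideanSpace.inner_single_right]

theorem laplacian_eq_sum_fderiv_gradient {N : ℕ} {f : Space N → ℝ} (hf : ContDiff ℝ ∞ f)
    (x : Space N) :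
    Laplacian.laplacian f x = ∑ i, (fderiv ℝ (gradient f) x (EuclideanSpace.single i 1)) i :=
  laplacian_eq_of_hasGradientAt (hasGradientAt_of_contDiff hf)
    ((contDiff_gradient hf).differentiable (by simp) x).hasFDerivAt

theorem continuous_laplacian {N : ℕ} {f : Space N → ℝ} (hf : ContDiff ℝ ∞ f) :
    Continuous (Laplacian.laplacian f) := by
  rw [funext (laplacian_eq_sum_fderiv_gradient hf)]
  have := ((contDiff_gradient hf).continuous_fderiv (by simp))
  fun_prop

theorem hasGradientAt_mul {N : ℕ} {f g : Space N → ℝ} {X Y x : Space N}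
    (hf : HasGradientAt f X x) (hg : HasGradientAt g Y x) :
    HasGradientAt (fun x => f x * g x) (f x • Y + g x • X) x := by
  rw [hasGradientAt_iff_hasFDerivAt] at *
  refine (hf.mul hg).congr_fderiv ?_
  ext v
  simp

theorem laplacian_mul {N : ℕ} {f g : Space N → ℝ} (hf : ContDiff ℝ ∞ f) (hg : ContDiff ℝ ∞ g)
    (x : Space N) :
    Laplacian.laplacian (fun x => f x * g x) x = f x * Laplacian.laplacian g x +
      2 * inner ℝ (gradient f x) (gradient g x) + g x * Laplacian.laplacian f x := by
  have h1 := fun x => hasGradientAt_mul (hasGradientAt_of_contDiff hf x)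
    (hasGradientAt_of_contDiff hg x)
  have hF := ((contDiff_gradient hf).differentiable (by simp) x).hasFDerivAt
  have hG := ((contDiff_gradient hg).differentiable (by simp) x).hasFDerivAt
  have hf1 := (hf.differentiable (by simp) x).hasFDerivAt
  have hg1 := (hg.differentiable (by simp) x).hasFDerivAt
  rw [laplacian_eq_of_hasGradientAt h1 ((hf1.smul hG).add (hg1.smul hF)),
    laplacian_eq_sum_fderiv_gradient hf, laplacian_eq_sum_fderiv_gradient hg]
  simp only [(hasGradientAt_of_contDiff hf x).fderiv_apply,
    (hasGradientAt_of_contDiff hg x).fderiv_apply, add_apply,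
    smul_apply, ContinuousLinearMap.smulRight_apply, PiLp.add_apply,
    PiLp.smul_apply, smul_eq_mul, PiLp.inner_apply]
  simp only [Finset.sum_add_distrib, Finset.mul_sum]
  simp
  simp only [← Finset.sum_add_distrib]
  refine Finset.sum_congr rfl fun i _ => ?_
  ring

/-- A radial potential with prescribed gradient `f (‖x - y‖ ^ 2 + δ ^ 2) (x - y)`. -/
theorem exists_radial_potential {N : ℕ} {f : ℝ → ℝ} (hf : ContDiffOn ℝ ∞ f (Set.Ioi 0))
    {δ : ℝ} (hδ : 0 < δ) (y : Space N) :
    ∃ Φ : Space N → ℝ, ContDiff ℝ ∞ Φ ∧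
      (∀ x, gradient Φ x = f (‖x - y‖ ^ 2 + δ ^ 2) • (x - y)) ∧
      ∀ x, Laplacian.laplacian Φ x = N * f (‖x - y‖ ^ 2 + δ ^ 2) +
        2 * ‖x - y‖ ^ 2 * deriv f (‖x - y‖ ^ 2 + δ ^ 2) := by
  -- The half cancels the factor in ∇‖x - y‖² = 2(x - y). The shift by δ² keeps the argument of `G`
  -- in the open half-line where `f` is smooth.
  set G : ℝ → ℝ := fun t => ∫ s in (1 : ℝ)..t, f s / 2 with hG
  have hfc : ContinuousOn f (Set.Ioi 0) := hf.continuousOn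
  have hGd : ∀ t ∈ Set.Ioi (0 : ℝ), HasDerivAt G (f t / 2) t := by
    intro t ht
    have hsub : Set.uIcc 1 t ⊆ Set.Ioi (0 : ℝ) := by
      intro s hs
      have := hs.1
      have h2 : 0 < min 1 t := lt_min one_pos ht
      exact lt_of_lt_of_le h2 this
    refine intervalIntegral.integral_hasDerivAt_right
      (((hfc.div_const 2).mono hsub).intervalIntegrable) ?_ ?_
    · exact (hfc.div_const 2).stronglyMeasurableAtFilter isOpen_Ioi t ht
    · exact (hfc.div_const 2).continuousAt (Ioi_mem_nhds ht)
  have hGs : ContDiffOn ℝ ∞ G (Set.Ioi 0) := by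
    rw [contDiffOn_infty_iff_deriv_of_isOpen isOpen_Ioi]
    refine ⟨fun t ht => (hGd t ht).differentiableAt.differentiableWithinAt, ?_⟩
    exact (hf.div_const 2).congr fun t ht => (hGd t ht).deriv
  have hpos : ∀ x : Space N, ‖x - y‖ ^ 2 + δ ^ 2 ∈ Set.Ioi (0 : ℝ) := fun x => by
    simp only [Set.mem_Ioi]; positivity
  have hts : ContDiff ℝ ∞ (fun x : Space N => ‖x - y‖ ^ 2 + δ ^ 2) :=
    ((contDiff_id.sub contDiff_const).norm_sq ℝ).add contDiff_const
  have htd : ∀ x, HasFDerivAt (fun x : Space N => ‖x - y‖ ^ 2 + δ ^ 2)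
      (2 • innerSL ℝ (x - y)) x := by
    intro x
    have := ((hasFDerivAt_id (𝕜 := ℝ) x).sub_const y).norm_sq.add_const (δ ^ 2)
    simpa using this
  have hgrad : ∀ x, HasGradientAt (fun x : Space N => G (‖x - y‖ ^ 2 + δ ^ 2))
      (f (‖x - y‖ ^ 2 + δ ^ 2) • (x - y)) x := by
    intro x
    rw [hasGradientAt_iff_hasFDerivAt]
    refine ((hGd _ (hpos x)).comp_hasFDerivAt x (htd x)).congr_fderiv ?_
    ext v
    simp
    ring
  refine ⟨fun x => G (‖x - y‖ ^ 2 + δ ^ 2), ?_, fun x => (hgrad x).gradient, fun x => ?_⟩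
  · rw [← contDiffOn_univ]
    exact hGs.comp hts.contDiffOn fun x _ => hpos x
  · have hfd : HasDerivAt f (deriv f (‖x - y‖ ^ 2 + δ ^ 2)) (‖x - y‖ ^ 2 + δ ^ 2) :=
      ((hf.differentiableOn (by simp) _ (hpos x)).differentiableAt
        (Ioi_mem_nhds (hpos x))).hasDerivAt
    rw [laplacian_eq_of_hasGradientAt hgrad ((hfd.comp_hasFDerivAt x (htd x)).smul
      ((hasFDerivAt_id (𝕜 := ℝ) x).sub_const y))]
    have hn : ‖x - y‖ ^ 2 = ∑ i, (x i - y i) * (x i - y i) := by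
      rw [EuclideanSpace.norm_sq_eq]
      simp [sq]
    simp [EuclideanSpace.inner_single_right, Finset.sum_add_distrib]
    generalize deriv f (‖x - y‖ ^ 2 + δ ^ 2) = d
    rw [hn]
    rw [Finset.mul_sum, Finset.sum_mul]
    refine Finset.sum_congr rfl fun i _ => ?_
    ring

/-! ### Dilated cutoffs and a larger class of test functions -/

theorem hasGradientAt_comp_smul {N : ℕ} {f : Space N → ℝ} (hf : ContDiff ℝ ∞ f) (s : ℝ)
    (x : Space N) :
    HasGradientAt (fun x => f (s • x)) (s • gradient f (s • x)) x := by
  have h := (hasGradientAt_of_contDiff hf (s • x)).hasFDerivAt.comp x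
    ((hasFDerivAt_id (𝕜 := ℝ) x).const_smul s)
  rw [hasGradientAt_iff_hasFDerivAt]
  refine h.congr_fderiv ?_
  ext v
  simp

theorem laplacian_comp_smul {N : ℕ} {f : Space N → ℝ} (hf : ContDiff ℝ ∞ f) (s : ℝ)
    (x : Space N) :
    Laplacian.laplacian (fun x => f (s • x)) x = s ^ 2 * Laplacian.laplacian f (s • x) := by
  have hF := ((contDiff_gradient hf).differentiable (by simp) (s • x)).hasFDerivAt
  rw [laplacian_eq_of_hasGradientAt (hasGradientAt_comp_smul hf s)
    ((hF.comp x ((hasFDerivAt_id (𝕜 := ℝ) x).const_smul s)).const_smul s),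
    laplacian_eq_sum_fderiv_gradient hf, Finset.mul_sum]
  refine Finset.sum_congr rfl fun i _ => ?_
  simp
  ring

theorem gradient_eq_zero_of_eventuallyEq_const {N : ℕ} {f : Space N → ℝ} {c : ℝ} {x : Space N}
    (h : f =ᶠ[𝓝 x] fun _ => c) : gradient f x = 0 := by
  rw [h.gradient_eq, gradient_fun_const]

theorem laplacian_eq_zero_of_eventuallyEq_const {N : ℕ} {f : Space N → ℝ} {c : ℝ} {x : Space N}
    (h : f =ᶠ[𝓝 x] fun _ => c) : Laplacian.laplacian f x = 0 := by
  rw [(InnerProductSpace.laplacian_congr_nhds h).self_of_nhds]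
  simp

/-- A smooth cutoff with `η = 1` on the unit ball, supported in the ball of radius `2`. -/
theorem exists_cutoff (N : ℕ) :
    ∃ η : Space N → ℝ, ContDiff ℝ ∞ η ∧ (∀ x, 0 ≤ η x ∧ η x ≤ 1) ∧
      (∀ x, ‖x‖ < 1 → η =ᶠ[𝓝 x] fun _ => 1) ∧ (∀ x, 2 < ‖x‖ → η =ᶠ[𝓝 x] fun _ => 0) ∧
      ∃ C, 0 < C ∧ ∀ x, ‖gradient η x‖ ≤ C ∧ |Laplacian.laplacian η x| ≤ C := by
  let b : ContDiffBump (0 : Space N) := ⟨1, 2, one_pos, one_lt_two⟩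
  have hb : ContDiff ℝ ∞ b := b.contDiff
  have hin : ∀ x, ‖x‖ < 1 → b =ᶠ[𝓝 x] fun _ => (1 : ℝ) := by
    intro x hx
    exact b.eventuallyEq_one_of_mem_ball (by simpa [b] using hx)
  have hout : ∀ x, 2 < ‖x‖ → b =ᶠ[𝓝 x] fun _ => (0 : ℝ) := by
    intro x hx
    filter_upwards [(isOpen_lt continuous_const continuous_norm).mem_nhds hx] with z hz
    exact b.zero_of_le_dist (by simpa [b] using (le_of_lt hz))
  refine ⟨b, hb, fun x => ⟨b.nonneg, b.le_one⟩, hin, hout, ?_⟩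
  obtain ⟨C1, h1⟩ := (isCompact_closedBall (0 : Space N) 2).exists_bound_of_continuousOn
    (contDiff_gradient hb).continuous.continuousOn
  obtain ⟨C2, h2⟩ := (isCompact_closedBall (0 : Space N) 2).exists_bound_of_continuousOn
    (continuous_laplacian hb).continuousOn
  refine ⟨max (max C1 C2) 1, by positivity, fun x => ?_⟩
  by_cases hx : 2 < ‖x‖
  · rw [gradient_eq_zero_of_eventuallyEq_const (hout x hx),
      laplacian_eq_zero_of_eventuallyEq_const (hout x hx)]
    simp
  · have hx' : x ∈ Metric.closedBall (0 : Space N) 2 := by simpa using hx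
    exact ⟨(h1 x hx').trans (le_max_of_le_left (le_max_left _ _)),
      (h2 x hx').trans (le_max_of_le_left (le_max_right _ _))⟩

/-- Mean value inequality on the segment from the origin. Linear growth is what a single factor s
from the gradient of the dilated cutoff η(s x) can absorb. -/
theorem abs_le_of_gradient_bound {N : ℕ} {Φ : Space N → ℝ} (hΦ : ContDiff ℝ ∞ Φ) {C : ℝ}
    (hC : ∀ x, ‖gradient Φ x‖ ≤ C) (x : Space N) : |Φ x| ≤ |Φ 0| + C * ‖x‖ := by
  have h := Convex.norm_image_sub_le_of_norm_fderiv_le (𝕜 := ℝ) (f := Φ) (C := C)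
    (s := Set.univ) (x := 0) (y := x)
    (fun z _ => hΦ.differentiable (by simp) z)
    (fun z _ => by
      rw [← toDual_gradient, LinearIsometryEquiv.norm_map]; exact hC z)
    convex_univ (Set.mem_univ _) (Set.mem_univ _)
  rw [sub_zero, Real.norm_eq_abs] at h
  have := abs_sub_abs_le_abs_sub (Φ x) (Φ 0)
  linarith

/-- The weak equation `ε ∫ m (-Δφ) = ∫ w · ∇φ` for test functions extends to smooth functions with
bounded gradient and Laplacian. -/
theorem weak_equation_of_bounded {N : ℕ} {m : Space N → ℝ} {w : Space N → Space N} {ε : ℝ}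
    (hm : Integrable m) (hw : Integrable w)
    (H : ∀ φ : Space N → ℝ, ContDiff ℝ ∞ φ → HasCompactSupport φ →
      ε * ∫ x, m x * (-(Laplacian.laplacian φ x)) = ∫ x, inner ℝ (w x) (gradient φ x))
    {Φ : Space N → ℝ} (hΦ : ContDiff ℝ ∞ Φ) {C : ℝ} (hC : ∀ x, ‖gradient Φ x‖ ≤ C)
    (hC' : ∀ x, |Laplacian.laplacian Φ x| ≤ C) :
    ε * ∫ x, m x * (-(Laplacian.laplacian Φ x)) = ∫ x, inner ℝ (w x) (gradient Φ x) := by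
  obtain ⟨η, hη, hη01, hη1, hη0, C0, hC0, hηC⟩ := exists_cutoff N
  have hCn : 0 ≤ C := (norm_nonneg _).trans (hC 0)
  set s : ℕ → ℝ := fun n => 1 / ((n : ℝ) + 1) with hs
  have hs0 : ∀ n, 0 < s n := fun n => by positivity
  have hs1 : ∀ n, s n ≤ 1 := fun n => by
    rw [hs]; simp only; rw [div_le_one (by positivity)]; linarith [(Nat.cast_nonneg n : (0:ℝ) ≤ n)]
  have hst : Filter.Tendsto s Filter.atTop (𝓝 0) := tendsto_one_div_add_atTop_nhds_zero_nat
  set χ : ℕ → Space N → ℝ := fun n x => η (s n • x) with hχ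
  have hχs : ∀ n, ContDiff ℝ ∞ (χ n) := fun n => hη.comp (contDiff_const_smul (s n))
  have hχg : ∀ n x, gradient (χ n) x = s n • gradient η (s n • x) := fun n x =>
    (hasGradientAt_comp_smul hη (s n) x).gradient
  have hχl : ∀ n x, Laplacian.laplacian (χ n) x = s n ^ 2 * Laplacian.laplacian η (s n • x) :=
    fun n x => laplacian_comp_smul hη (s n) x
  set φ : ℕ → Space N → ℝ := fun n x => χ n x * Φ x with hφ
  have hφs : ∀ n, ContDiff ℝ ∞ (φ n) := fun n => (hχs n).mul hΦ
  have hφc : ∀ n, HasCompactSupport (φ n) := by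
    intro n
    refine HasCompactSupport.intro (isCompact_closedBall (0 : Space N) (2 / s n)) fun x hx => ?_
    have : 2 < ‖s n • x‖ := by
      rw [mem_closedBall_zero_iff, not_le, div_lt_iff₀ (hs0 n)] at hx
      rw [norm_smul, Real.norm_of_nonneg (hs0 n).le]; linarith
    simp [φ, χ, (hη0 _ this).self_of_nhds]
  have hφg : ∀ n x, gradient (φ n) x = χ n x • gradient Φ x + Φ x • gradient (χ n) x := fun n x =>
    (hasGradientAt_mul (hasGradientAt_of_contDiff (hχs n) x)
      (hasGradientAt_of_contDiff hΦ x)).gradient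
  have hφl := fun n x => laplacian_mul (hχs n) hΦ x
  -- Near a fixed point the cutoff is eventually identically 1, so the derivatives of `φ n` there
  -- eventually equal those of `Φ`. This gives pointwise convergence of both integrands.
  have hχev : ∀ x, ∀ᶠ n in Filter.atTop, χ n =ᶠ[𝓝 x] fun _ => 1 := by
    intro x
    have h1 : Filter.Tendsto (fun n => ‖s n • x‖) Filter.atTop (𝓝 0) := by
      simpa using (hst.smul_const x).norm
    filter_upwards [h1.eventually_lt_const one_pos] with n hn
    have hc : Filter.Tendsto (fun z : Space N => s n • z) (𝓝 x) (𝓝 (s n • x)) :=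
      (continuous_const_smul (s n)).tendsto x
    exact hc.eventually (hη1 _ hn)
  have hχb : ∀ n x, |χ n x| ≤ 1 := fun n x => by
    rw [abs_of_nonneg (hη01 _).1]; exact (hη01 _).2
  have hχgb : ∀ n x, ‖gradient (χ n) x‖ ≤ C0 := fun n x => by
    rw [hχg, norm_smul, Real.norm_of_nonneg (hs0 n).le]
    exact (mul_le_mul (hs1 n) (hηC _).1 (norm_nonneg _) zero_le_one).trans (by simp)
  set D : ℝ := |Φ 0| + C * 2 with hD
  -- On the support of the cutoff ‖x‖ ≤ 2 / s n, so `Φ` is at most of order 1 / s n there. This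
  -- makes the cross terms Φ∇χ and ΦΔχ bounded uniformly in n, which is all that dominated
  -- convergence requires.
  have hsΦ : ∀ n x, ‖s n • x‖ ≤ 2 → s n * |Φ x| ≤ D := by
    intro n x hx
    rw [norm_smul, Real.norm_of_nonneg (hs0 n).le] at hx
    have h1 := abs_le_of_gradient_bound hΦ hC x
    calc s n * |Φ x| ≤ s n * (|Φ 0| + C * ‖x‖) := mul_le_mul_of_nonneg_left h1 (hs0 n).le
      _ = s n * |Φ 0| + C * (s n * ‖x‖) := by ring
      _ ≤ 1 * |Φ 0| + C * 2 := add_le_add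
          (mul_le_mul_of_nonneg_right (hs1 n) (abs_nonneg _)) (mul_le_mul_of_nonneg_left hx hCn)
      _ = D := by rw [hD, one_mul]
  have hΦg : ∀ n x, ‖Φ x • gradient (χ n) x‖ ≤ D * C0 := by
    intro n x
    have hD0 : 0 ≤ D := by positivity
    by_cases hx : ‖s n • x‖ ≤ 2
    · rw [hχg, norm_smul, norm_smul, Real.norm_of_nonneg (hs0 n).le, Real.norm_eq_abs]
      calc _ = (s n * |Φ x|) * ‖gradient η (s n • x)‖ := by ring
        _ ≤ D * C0 := mul_le_mul (hsΦ n x hx) (hηC _).1 (norm_nonneg _) hD0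
    · rw [hχg, gradient_eq_zero_of_eventuallyEq_const (hη0 _ (not_le.1 hx))]
      simp; positivity
  have hΦl : ∀ n x, |Φ x * Laplacian.laplacian (χ n) x| ≤ D * C0 := by
    intro n x
    have hD0 : 0 ≤ D := by positivity
    by_cases hx : ‖s n • x‖ ≤ 2
    · rw [hχl, abs_mul, abs_mul, abs_of_nonneg (sq_nonneg (s n))]
      calc _ = (s n * |Φ x|) * (s n * |Laplacian.laplacian η (s n • x)|) := by ring
        _ ≤ D * (1 * C0) := mul_le_mul (hsΦ n x hx)
            (mul_le_mul (hs1 n) (hηC _).2 (abs_nonneg _) zero_le_one)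
            (mul_nonneg (hs0 n).le (abs_nonneg _)) hD0
        _ = D * C0 := by ring
    · rw [hχl, laplacian_eq_zero_of_eventuallyEq_const (hη0 _ (not_le.1 hx))]
      simp; positivity
  have hL : ∀ n x, |Laplacian.laplacian (φ n) x| ≤ C + 2 * (C0 * C) + D * C0 := by
    intro n x
    rw [hφl]
    refine (abs_add_three _ _ _).trans (add_le_add (add_le_add ?_ ?_) (hΦl n x))
    · rw [abs_mul]
      exact (mul_le_mul (hχb n x) (hC' x) (abs_nonneg _) zero_le_one).trans (by simp)
    · rw [abs_mul, abs_two]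
      refine mul_le_mul_of_nonneg_left ?_ zero_le_two
      exact (abs_real_inner_le_norm _ _).trans
        (mul_le_mul (hχgb n x) (hC x) (norm_nonneg _) hC0.le)
  have hG : ∀ n x, ‖gradient (φ n) x‖ ≤ C + D * C0 := by
    intro n x
    rw [hφg]
    refine (norm_add_le _ _).trans (add_le_add ?_ (hΦg n x))
    rw [norm_smul, Real.norm_eq_abs]
    exact (mul_le_mul (hχb n x) (hC x) (norm_nonneg _) zero_le_one).trans (by simp)
  have hlim1 : Filter.Tendsto (fun n => ∫ x, m x * (-(Laplacian.laplacian (φ n) x))) Filter.atTop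
      (𝓝 (∫ x, m x * (-(Laplacian.laplacian Φ x)))) := by
    refine tendsto_integral_of_dominated_convergence
      (fun x => ‖m x‖ * (C + 2 * (C0 * C) + D * C0)) (fun n => ?_) (hm.norm.mul_const _)
      (fun n => ?_) ?_
    · exact hm.aestronglyMeasurable.mul (continuous_laplacian (hφs n)).neg.aestronglyMeasurable
    · refine Filter.Eventually.of_forall fun x => ?_
      rw [norm_mul, norm_neg]
      exact mul_le_mul_of_nonneg_left (hL n x) (norm_nonneg _)
    · refine Filter.Eventually.of_forall fun x => ?_
      refine tendsto_const_nhds.congr' ?_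
      filter_upwards [hχev x] with n hn
      rw [hφl, gradient_eq_zero_of_eventuallyEq_const hn,
        laplacian_eq_zero_of_eventuallyEq_const hn, hn.self_of_nhds]
      simp
  have hlim2 : Filter.Tendsto (fun n => ∫ x, inner ℝ (w x) (gradient (φ n) x)) Filter.atTop
      (𝓝 (∫ x, inner ℝ (w x) (gradient Φ x))) := by
    refine tendsto_integral_of_dominated_convergence
      (fun x => ‖w x‖ * (C + D * C0)) (fun n => ?_) (hw.norm.mul_const _)
      (fun n => ?_) ?_
    · exact hw.aestronglyMeasurable.inner
        (contDiff_gradient (hφs n)).continuous.aestronglyMeasurable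
    · refine Filter.Eventually.of_forall fun x => ?_
      exact (abs_real_inner_le_norm _ _).trans
        (mul_le_mul_of_nonneg_left (hG n x) (norm_nonneg _))
    · refine Filter.Eventually.of_forall fun x => ?_
      refine tendsto_const_nhds.congr' ?_
      filter_upwards [hχev x] with n hn
      rw [hφg, gradient_eq_zero_of_eventuallyEq_const hn, hn.self_of_nhds]
      simp
  refine tendsto_nhds_unique (hlim1.const_mul ε) ?_
  refine hlim2.congr fun n => ?_
  exact (H (φ n) (hφs n) (hφc n)).symm

/-! ### Potentials whose Laplacian dominates the Riesz kernel -/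

/-- Young's inequality with three factors and a small constant on the first power. -/
theorem exists_young_const {g q r B θ : ℝ} (hg : 0 < g) (hq : 0 ≤ q) (hr : 0 < r)
    (h1 : 1 / g + q + r = 1) (hB : 0 < B) (hθ : 0 < θ) :
    ∃ C, 0 < C ∧ ∀ l Q E : ℝ, 0 ≤ l → 0 ≤ Q → 0 < E →
      B * l * Q ^ q * E ^ r ≤ Q + θ * l ^ g + C * E := by
  have hp : 0 < 1 / g := by positivity
  -- Weighted AM-GM is applied to θ l^g, Q and C E with weights 1/g, q, r; the constant solves
  -- θ^(1/g) C^r = B. The weights, all at most 1, are then dropped on the right.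
  refine ⟨(B * θ ^ (-(1 / g))) ^ (1 / r), by positivity, fun l Q E hl hQ hE => ?_⟩
  set C := (B * θ ^ (-(1 / g))) ^ (1 / r) with hC
  have hC0 : 0 ≤ C := by positivity
  have hCr : C ^ r = B * θ ^ (-(1 / g)) := by
    rw [hC, ← Real.rpow_mul (by positivity), one_div_mul_cancel hr.ne', Real.rpow_one]
  have hlg : (l ^ g) ^ (1 / g) = l := by
    rw [← Real.rpow_mul hl, mul_one_div_cancel hg.ne', Real.rpow_one]
  have hθθ : θ ^ (1 / g) * θ ^ (-(1 / g)) = 1 := by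
    rw [← Real.rpow_add hθ]; simp
  have key := Real.geom_mean_le_arith_mean3_weighted hp.le hq hr.le
    (p₁ := θ * l ^ g) (p₂ := Q) (p₃ := C * E) (by positivity) hQ (by positivity) h1
  rw [Real.mul_rpow hθ.le (by positivity), hlg, Real.mul_rpow hC0 hE.le, hCr] at key
  calc B * l * Q ^ q * E ^ r
      = (θ ^ (1 / g) * θ ^ (-(1 / g))) * (B * l * Q ^ q * E ^ r) := by rw [hθθ, one_mul]
    _ = θ ^ (1 / g) * l * Q ^ q * (B * θ ^ (-(1 / g)) * E ^ r) := by ring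
    _ ≤ _ := key
    _ ≤ 1 * (θ * l ^ g) + 1 * Q + 1 * (C * E) := by
        have : 0 ≤ θ * l ^ g := by positivity
        have : 0 ≤ C * E := by positivity
        gcongr <;> linarith
    _ = _ := by ring

theorem le_rpow_half_sq_add_sq (z δ : ℝ) : z ≤ (z ^ 2 + δ ^ 2) ^ (1 / 2 : ℝ) := by
  rw [← Real.sqrt_eq_rpow]
  exact Real.le_sqrt_of_sq_le (by nlinarith [sq_nonneg δ])

/-- A potential whose Laplacian dominates the kernel `|x - y|^(-a)` (regularised at scale `δ`), up
to terms which the kinetic energy controls: the case `1 ≤ a`. -/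
theorem exists_dominating_potential_of_one_le {N : ℕ} {a g θ : ℝ} (ha : 1 ≤ a) (haN : a < N)
    (hag : a < g) (hθ : 0 < θ) :
    ∃ C, 0 < C ∧ ∀ ε δ : ℝ, 0 < ε → 0 < δ → ∀ y : Space N, ∃ (Φ : Space N → ℝ) (B K : ℝ),
      ContDiff ℝ ∞ Φ ∧ 0 < B ∧ (∀ x, ‖gradient Φ x‖ ≤ K) ∧
      (∀ x, |Laplacian.laplacian Φ x| ≤ K) ∧ ∀ x l, 0 ≤ l →
        (‖x - y‖ ^ 2 + δ ^ 2) ^ (-a / 2) + B / ε * l * ‖gradient Φ x‖ ≤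
          B * Laplacian.laplacian Φ x + θ * l ^ g + C * ε ^ (-(g * a / (g - a))) := by
  have ha0 : 0 < a := by linarith
  have hg0 : 0 < g := by linarith
  have hga : 0 < g - a := by linarith
  have hNa : 0 < (N : ℝ) - a := by linarith
  -- The exponents are forced by Q = t^(-a/2) and E = ε^(-ga/(g-a)): then Q^q = t^((1-a)/2) bounds
  -- |∇Φ| and E^r = 1/ε. The factor 2/(N - a) makes B ΔΦ ≥ 2Q; one Q pays for the kernel and the
  -- other for Young's inequality.
  obtain ⟨C, hC, hY⟩ := exists_young_const (g := g) (q := (a - 1) / a) (r := (g - a) / (a * g))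
    (B := 2 / (N - a)) hg0 (div_nonneg (by linarith) ha0.le) (by positivity)
    (by field_simp; ring) (by positivity) hθ
  refine ⟨C, hC, fun ε δ hε hδ y => ?_⟩
  obtain ⟨Φ, hΦ, hgr, hlap⟩ := exists_radial_potential (N := N) (f := fun t => t ^ (-a / 2))
    (fun t ht => (Real.contDiffAt_rpow_const_of_ne (ne_of_gt ht)).contDiffWithinAt) hδ y
  have hδ2 : 0 < δ ^ 2 := by positivity
  have ht0 : ∀ x, 0 < ‖x - y‖ ^ 2 + δ ^ 2 := fun x => by positivity
  have hlap' : ∀ x, Laplacian.laplacian Φ x = (‖x - y‖ ^ 2 + δ ^ 2) ^ (-a / 2) *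
      (N - a * (‖x - y‖ ^ 2 / (‖x - y‖ ^ 2 + δ ^ 2))) := by
    intro x
    rw [hlap, Real.deriv_rpow_const, Real.rpow_sub_one (ht0 x).ne']
    ring
  have hfrac : ∀ x, 0 ≤ ‖x - y‖ ^ 2 / (‖x - y‖ ^ 2 + δ ^ 2) ∧
      ‖x - y‖ ^ 2 / (‖x - y‖ ^ 2 + δ ^ 2) ≤ 1 := fun x =>
    ⟨by positivity, by rw [div_le_one (ht0 x)]; linarith⟩
  have hgr' : ∀ x, ‖gradient Φ x‖ ≤ (‖x - y‖ ^ 2 + δ ^ 2) ^ ((1 - a) / 2) := by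
    intro x
    rw [hgr, norm_smul, Real.norm_of_nonneg (by positivity),
      show (1 - a) / 2 = -a / 2 + 1 / 2 by ring, Real.rpow_add (ht0 x)]
    exact mul_le_mul_of_nonneg_left (le_rpow_half_sq_add_sq _ _) (by positivity)
  refine ⟨Φ, 2 / (N - a), max ((δ ^ 2) ^ ((1 - a) / 2)) ((δ ^ 2) ^ (-a / 2) * N), hΦ,
    by positivity, fun x => ?_, fun x => ?_, fun x l hl => ?_⟩
  · refine le_max_of_le_left ((hgr' x).trans ?_)
    exact Real.rpow_le_rpow_of_nonpos hδ2 (by nlinarith [sq_nonneg ‖x - y‖]) (by linarith)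
  · refine le_max_of_le_right ?_
    have h1 := hfrac x
    rw [hlap', abs_mul, abs_of_nonneg (by positivity : 0 ≤ (‖x - y‖ ^ 2 + δ ^ 2) ^ (-a / 2)),
      abs_of_nonneg (by nlinarith)]
    refine mul_le_mul ?_ (by nlinarith) (by nlinarith) (by positivity)
    exact Real.rpow_le_rpow_of_nonpos hδ2 (by nlinarith [sq_nonneg ‖x - y‖]) (by linarith)
  · set t := ‖x - y‖ ^ 2 + δ ^ 2 with ht
    set Q := t ^ (-a / 2) with hQ
    have hQ0 : 0 < Q := Real.rpow_pos_of_pos (ht0 x) _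
    have hE : (ε ^ (-(g * a / (g - a)))) ^ ((g - a) / (a * g)) = ε⁻¹ := by
      rw [← Real.rpow_mul hε.le, ← Real.rpow_neg_one]
      congr 1
      field_simp
    have hQq : Q ^ ((a - 1) / a) = t ^ ((1 - a) / 2) := by
      rw [hQ, ← Real.rpow_mul (ht0 x).le]
      congr 1
      field_simp
      ring
    have hy := hY l Q (ε ^ (-(g * a / (g - a)))) hl hQ0.le (by positivity)
    rw [hE, hQq] at hy
    have h2 : 2 * Q ≤ 2 / (N - a) * Laplacian.laplacian Φ x := by
      rw [hlap', div_mul_eq_mul_div, le_div_iff₀ hNa, mul_assoc]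
      refine mul_le_mul_of_nonneg_left (mul_le_mul_of_nonneg_left ?_ hQ0.le) zero_le_two
      nlinarith [hfrac x]
    have h3 : 2 / (N - a) / ε * l * ‖gradient Φ x‖ ≤ 2 / (N - a) * l * t ^ ((1 - a) / 2) * ε⁻¹ := by
      calc 2 / (N - a) / ε * l * ‖gradient Φ x‖ ≤ 2 / (N - a) / ε * l * t ^ ((1 - a) / 2) :=
            mul_le_mul_of_nonneg_left (hgr' x) (by positivity)
        _ = _ := by ring
    linarith

/-- The analogue of `exists_dominating_potential_of_one_le` for `a < 1`; the field is cut off at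
the scale `ε ^ (g / (g - a))`, beyond which the kernel is bounded. -/
theorem exists_dominating_potential_of_lt_one {N : ℕ} {a g θ : ℝ} (ha0 : 0 < a) (ha : a < 1)
    (hN : 1 ≤ N) (hg : 1 < g) (hθ : 0 < θ) :
    ∃ C, 0 < C ∧ ∀ ε δ : ℝ, 0 < ε → 0 < δ → ∀ y : Space N, ∃ (Φ : Space N → ℝ) (B K : ℝ),
      ContDiff ℝ ∞ Φ ∧ 0 < B ∧ (∀ x, ‖gradient Φ x‖ ≤ K) ∧
      (∀ x, |Laplacian.laplacian Φ x| ≤ K) ∧ ∀ x l, 0 ≤ l →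
        (‖x - y‖ ^ 2 + δ ^ 2) ^ (-a / 2) + B / ε * l * ‖gradient Φ x‖ ≤
          B * Laplacian.laplacian Φ x + θ * l ^ g + C * ε ^ (-(g * a / (g - a))) := by
  have hg0 : 0 < g := by linarith
  have hga : 0 < g - a := by linarith
  have h1a : 0 < 1 - a := by linarith
  have hN1 : (1 : ℝ) ≤ N := by exact_mod_cast hN
  obtain ⟨C, hC, hY⟩ := exists_young_const (g := g) (q := 0) (r := (g - 1) / g)
    (B := 4 / (1 - a)) hg0 le_rfl (div_pos (by linarith) hg0)
    (by field_simp; ring) (by positivity) hθ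
  -- `C` comes from Young's inequality; the extra 1 pays for the kernel beyond distance `ρ`.
  refine ⟨C + 1, by positivity, fun ε δ hε hδ y => ?_⟩
  set ρ := ε ^ (g / (g - a)) with hρ
  have hρ0 : 0 < ρ := by positivity
  have hfd : ∀ t : ℝ, 0 < t → HasDerivAt (fun t => t ^ (-a / 2) * (t + ρ ^ 2) ^ (-(1 - a) / 2))
      (t ^ (-a / 2) * (t + ρ ^ 2) ^ (-(1 - a) / 2) *
        (-a / 2 / t + -(1 - a) / 2 / (t + ρ ^ 2))) t := by
    intro t ht
    have htρ : 0 < t + ρ ^ 2 := by positivity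
    have h1 := Real.hasDerivAt_rpow_const (x := t) (p := -a / 2) (Or.inl ht.ne')
    have h2 := ((hasDerivAt_id t).add_const (ρ ^ 2)).rpow_const (p := -(1 - a) / 2)
      (Or.inl htρ.ne')
    refine (h1.mul h2).congr_deriv ?_
    simp only [id]
    rw [Real.rpow_sub_one ht.ne', Real.rpow_sub_one htρ.ne']
    ring
  obtain ⟨Φ, hΦ, hgr, hlap⟩ := exists_radial_potential (N := N)
    (f := fun t => t ^ (-a / 2) * (t + ρ ^ 2) ^ (-(1 - a) / 2))
    (fun t ht => ((Real.contDiffAt_rpow_const_of_ne (ne_of_gt ht)).mul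
      ((contDiffAt_id.add contDiffAt_const).rpow_const_of_ne
        (by have : 0 < t := ht
            simp only [id]; positivity))).contDiffWithinAt) hδ y
  have hδ2 : 0 < δ ^ 2 := by positivity
  have ht0 : ∀ x, 0 < ‖x - y‖ ^ 2 + δ ^ 2 := fun x => by positivity
  set f : ℝ → ℝ := fun t => t ^ (-a / 2) * (t + ρ ^ 2) ^ (-(1 - a) / 2) with hf
  have hf0 : ∀ t, 0 < t → 0 < f t := fun t ht => by
    have : 0 < t + ρ ^ 2 := by positivity
    exact mul_pos (Real.rpow_pos_of_pos ht _) (Real.rpow_pos_of_pos this _)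
  have hlap' : ∀ x, Laplacian.laplacian Φ x = f (‖x - y‖ ^ 2 + δ ^ 2) *
      (N - a * (‖x - y‖ ^ 2 / (‖x - y‖ ^ 2 + δ ^ 2)) -
        (1 - a) * (‖x - y‖ ^ 2 / (‖x - y‖ ^ 2 + δ ^ 2 + ρ ^ 2))) := by
    intro x
    rw [hlap, (hfd _ (ht0 x)).deriv]
    ring
  have hfrac : ∀ x, 0 ≤ ‖x - y‖ ^ 2 / (‖x - y‖ ^ 2 + δ ^ 2) ∧
      ‖x - y‖ ^ 2 / (‖x - y‖ ^ 2 + δ ^ 2) ≤ 1 := fun x =>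
    ⟨by positivity, by rw [div_le_one (ht0 x)]; linarith⟩
  have hfrac' : ∀ x, 0 ≤ ‖x - y‖ ^ 2 / (‖x - y‖ ^ 2 + δ ^ 2 + ρ ^ 2) ∧
      ‖x - y‖ ^ 2 / (‖x - y‖ ^ 2 + δ ^ 2 + ρ ^ 2) ≤
        1 - ρ ^ 2 / (‖x - y‖ ^ 2 + δ ^ 2 + ρ ^ 2) := fun x => by
    have : 0 < ‖x - y‖ ^ 2 + δ ^ 2 + ρ ^ 2 := by positivity
    refine ⟨by positivity, ?_⟩
    rw [le_sub_iff_add_le, ← add_div, div_le_one this]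
    linarith
  -- Since N ≥ 1, the bracket is at least N - a - (1 - a) ≥ 0 plus the gain from the damping. That
  -- gain is what keeps the Laplacian positive when N = 1.
  have hlow : ∀ x, f (‖x - y‖ ^ 2 + δ ^ 2) *
      ((1 - a) * (ρ ^ 2 / (‖x - y‖ ^ 2 + δ ^ 2 + ρ ^ 2))) ≤ Laplacian.laplacian Φ x := fun x => by
    rw [hlap']
    refine mul_le_mul_of_nonneg_left ?_ (hf0 _ (ht0 x)).le
    have h1 := mul_le_mul_of_nonneg_left (hfrac x).2 ha0.le
    have h2 := mul_le_mul_of_nonneg_left (hfrac' x).2 h1a.le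
    linarith
  have hlap0 : ∀ x, 0 ≤ Laplacian.laplacian Φ x := fun x => by
    refine le_trans ?_ (hlow x)
    have := (hf0 _ (ht0 x)).le
    positivity
  have hgr' : ∀ x, ‖gradient Φ x‖ ≤ 1 := by
    intro x
    have ht := ht0 x
    rw [hgr, norm_smul, Real.norm_of_nonneg (hf0 _ (ht0 x)).le]
    calc _ ≤ ((‖x - y‖ ^ 2 + δ ^ 2) ^ (-a / 2) * (‖x - y‖ ^ 2 + δ ^ 2) ^ (-(1 - a) / 2)) *
          (‖x - y‖ ^ 2 + δ ^ 2) ^ (1 / 2 : ℝ) := by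
          refine mul_le_mul (mul_le_mul_of_nonneg_left ?_ (by positivity))
            (le_rpow_half_sq_add_sq _ _) (norm_nonneg _) (by positivity)
          exact Real.rpow_le_rpow_of_nonpos ht (by nlinarith [sq_nonneg ρ]) (by linarith)
      _ = 1 := by
          rw [← Real.rpow_add ht, ← Real.rpow_add ht,
            show -a / 2 + -(1 - a) / 2 + 1 / 2 = 0 by ring, Real.rpow_zero]
  refine ⟨Φ, 4 / (1 - a) * ρ ^ (1 - a),
    max 1 ((δ ^ 2) ^ (-a / 2) * (δ ^ 2) ^ (-(1 - a) / 2) * N), hΦ,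
    by positivity, fun x => le_max_of_le_left (hgr' x), fun x => ?_, fun x l hl => ?_⟩
  · refine le_max_of_le_right ?_
    rw [abs_of_nonneg (hlap0 x), hlap']
    refine mul_le_mul (mul_le_mul ?_ ?_ (by positivity) (by positivity)) ?_ ?_ (by positivity)
    · exact Real.rpow_le_rpow_of_nonpos hδ2 (by nlinarith [sq_nonneg ‖x - y‖]) (by linarith)
    · exact Real.rpow_le_rpow_of_nonpos hδ2 (by nlinarith [sq_nonneg ‖x - y‖, sq_nonneg ρ])
        (by linarith)
    · nlinarith [hfrac x, hfrac' x]
    · have h := hlap0 x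
      rw [hlap'] at h
      exact nonneg_of_mul_nonneg_right h (hf0 _ (ht0 x))
  · set E := ε ^ (-(g * a / (g - a))) with hE
    have hE1 : E ^ ((g - 1) / g) = ρ ^ (1 - a) * ε⁻¹ := by
      rw [hE, hρ, ← Real.rpow_mul hε.le, ← Real.rpow_mul hε.le, ← Real.rpow_neg_one,
        ← Real.rpow_add hε]
      congr 1
      field_simp
      ring
    have hE2 : ρ ^ (-a) = E := by
      rw [hE, hρ, ← Real.rpow_mul hε.le]
      congr 1
      field_simp
    have hy := hY l 0 E hl le_rfl (by positivity)
    rw [hE1, Real.rpow_zero, mul_one, zero_add] at hy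
    have h3 : 4 / (1 - a) * ρ ^ (1 - a) / ε * l * ‖gradient Φ x‖ ≤
        4 / (1 - a) * l * (ρ ^ (1 - a) * ε⁻¹) := by
      calc _ ≤ 4 / (1 - a) * ρ ^ (1 - a) / ε * l * 1 :=
            mul_le_mul_of_nonneg_left (hgr' x) (by positivity)
        _ = _ := by ring
    -- For t ≤ ρ² the damping factor, once multiplied by ρ^(1-a), and the fraction ρ²/(t + ρ²) are
    -- both at least 1/2, whence the 4. For t > ρ² the kernel itself is at most ρ^(-a) = E.
    have h4 : (‖x - y‖ ^ 2 + δ ^ 2) ^ (-a / 2) ≤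
        4 / (1 - a) * ρ ^ (1 - a) * Laplacian.laplacian Φ x + E := by
      have ht := ht0 x
      have hl0 := hlow x
      have hl1 := hlap0 x
      set t := ‖x - y‖ ^ 2 + δ ^ 2
      by_cases htρ : t ≤ ρ ^ 2
      · have hE0 : 0 ≤ E := by positivity
        refine le_trans ?_ (le_add_of_nonneg_right hE0)
        have h5 : ρ ^ (1 - a) * (t + ρ ^ 2) ^ (-(1 - a) / 2) ≥ 1 / 2 := by
          have h6 : (t + ρ ^ 2) ^ (-(1 - a) / 2) ≥ (2 * ρ ^ 2) ^ (-(1 - a) / 2) :=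
            Real.rpow_le_rpow_of_nonpos (by positivity) (by linarith) (by linarith)
          have h7 : (2 * ρ ^ 2) ^ (-(1 - a) / 2) = 2 ^ (-(1 - a) / 2) * ρ ^ (-(1 - a)) := by
            rw [Real.mul_rpow zero_le_two (by positivity), ← Real.rpow_natCast ρ 2,
              ← Real.rpow_mul hρ0.le]
            congr 2
            push_cast
            ring
          have h8 : (2 : ℝ) ^ (-(1 - a) / 2) ≥ 2 ^ (-1 : ℝ) :=
            Real.rpow_le_rpow_of_exponent_le one_le_two (by linarith)
          rw [Real.rpow_neg_one] at h8
          have h9 : ρ ^ (1 - a) * ρ ^ (-(1 - a)) = 1 := by rw [← Real.rpow_add hρ0]; simp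
          calc ρ ^ (1 - a) * (t + ρ ^ 2) ^ (-(1 - a) / 2)
              ≥ ρ ^ (1 - a) * (2 ^ (-(1 - a) / 2) * ρ ^ (-(1 - a))) := by
                rw [← h7]; exact mul_le_mul_of_nonneg_left h6 (by positivity)
            _ = 2 ^ (-(1 - a) / 2) * (ρ ^ (1 - a) * ρ ^ (-(1 - a))) := by ring
            _ ≥ 1 / 2 := by rw [h9]; linarith
        have h10 : ρ ^ 2 / (t + ρ ^ 2) ≥ 1 / 2 := by
          rw [ge_iff_le, div_le_div_iff₀ (by norm_num) (by positivity)]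
          linarith
        have htp : 0 < t ^ (-a / 2) := Real.rpow_pos_of_pos ht _
        calc t ^ (-a / 2) = t ^ (-a / 2) * (4 * (1 / 2 * (1 / 2))) := by norm_num
          _ ≤ t ^ (-a / 2) * (4 * ((ρ ^ (1 - a) * (t + ρ ^ 2) ^ (-(1 - a) / 2)) *
              (ρ ^ 2 / (t + ρ ^ 2)))) := by
              refine mul_le_mul_of_nonneg_left (mul_le_mul_of_nonneg_left ?_ (by norm_num)) htp.le
              exact mul_le_mul h5 h10 (by norm_num) (by linarith)
          _ = 4 / (1 - a) * ρ ^ (1 - a) * (f t * ((1 - a) * (ρ ^ 2 / (t + ρ ^ 2)))) := by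
              simp only [hf]; field_simp
          _ ≤ _ := mul_le_mul_of_nonneg_left hl0 (by positivity)
      · have h5 : t ^ (-a / 2) ≤ (ρ ^ 2) ^ (-a / 2) :=
          Real.rpow_le_rpow_of_nonpos (by positivity) (not_le.1 htρ).le (by linarith)
        have h6 : (ρ ^ 2) ^ (-a / 2) = E := by
          rw [← hE2, ← Real.rpow_natCast ρ 2, ← Real.rpow_mul hρ0.le]
          congr 1
          push_cast
          ring
        have : 0 ≤ 4 / (1 - a) * ρ ^ (1 - a) * Laplacian.laplacian Φ x := by positivity
        linarith
    linarith

/-! ### Lower bound: kinetic energy controls the interaction -/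

theorem measurable_kineticDensity (N : ℕ) (g : ℝ) :
    Measurable fun p : ℝ × Space N => kineticDensity g p.1 p.2 := by
  unfold kineticDensity
  refine Measurable.ite (measurableSet_lt measurable_const measurable_fst) ?_
    (Measurable.ite ?_ measurable_const measurable_const)
  · fun_prop
  · exact (measurableSet_eq_fun measurable_fst measurable_const).inter
      (measurableSet_eq_fun measurable_snd measurable_const)

/-- Where the kinetic density is finite, it is given by the real-valued formula and the flux
vanishes on the zero set of the density. -/
theorem kineticDensity_of_ne_top {N : ℕ} {g m : ℝ} {w : Space N}
    (h : kineticDensity g m w ≠ ⊤) :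
    kineticDensity g m w = ENNReal.ofReal (m * (1 / g * ‖m⁻¹ • w‖ ^ g)) ∧ (m = 0 → w = 0) := by
  unfold kineticDensity at *
  by_cases hm : 0 < m
  · simp only [if_pos hm, true_and]
    intro h0
    exact absurd h0 hm.ne'
  · by_cases h0 : m = 0 ∧ w = 0
    · simp [h0]
    · simp [hm, h0] at h

/-- Pointwise bound for the Riesz potential of the density of an admissible pair by its kinetic
energy. -/
theorem exists_rieszPotential_bound {N : ℕ} {a g θ : ℝ} (hN : 1 ≤ N) (ha : 0 < a) (haN : a < N)
    (hg : 1 < g) (hag : a < g) (hθ : 0 < θ) :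
    ∃ C, 0 < C ∧ ∀ (ε M : ℝ) (m : Space N → ℝ) (w : Space N → Space N), 0 < ε →
      (m, w) ∈ constraintSet N g ε M → ∫⁻ x, kineticDensity g (m x) (w x) ≠ ⊤ → ∀ y,
        ∫⁻ x, ENNReal.ofReal (m x / ‖x - y‖ ^ a) ≤
          ENNReal.ofReal (θ * g * (∫⁻ x, kineticDensity g (m x) (w x)).toReal +
            C * ε ^ (-(g * a / (g - a))) * M) := by
  have hdom : ∃ C, 0 < C ∧ ∀ ε δ : ℝ, 0 < ε → 0 < δ → ∀ y : Space N,
      ∃ (Φ : Space N → ℝ) (B K : ℝ),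
      ContDiff ℝ ∞ Φ ∧ 0 < B ∧ (∀ x, ‖gradient Φ x‖ ≤ K) ∧
      (∀ x, |Laplacian.laplacian Φ x| ≤ K) ∧ ∀ x l, 0 ≤ l →
        (‖x - y‖ ^ 2 + δ ^ 2) ^ (-a / 2) + B / ε * l * ‖gradient Φ x‖ ≤
          B * Laplacian.laplacian Φ x + θ * l ^ g + C * ε ^ (-(g * a / (g - a))) := by
    rcases le_or_gt 1 a with h | h
    · exact exists_dominating_potential_of_one_le h haN hag hθ
    · exact exists_dominating_potential_of_lt_one ha h hN hg hθ
  obtain ⟨C, hC, hdom⟩ := hdom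
  refine ⟨C, hC, fun ε M m w hε hmw hP y => ?_⟩
  obtain ⟨hm1, -, hw1, hM, hm0, H⟩ := hmw
  simp only at hm1 hw1 hM hm0 H
  have hm : Integrable m := memLp_one_iff_integrable.1 hm1
  have hw : Integrable w := memLp_one_iff_integrable.1 hw1
  have hmeas : AEMeasurable fun x => kineticDensity g (m x) (w x) :=
    (measurable_kineticDensity N g).comp_aemeasurable
      (hm.aestronglyMeasurable.aemeasurable.prodMk hw.aestronglyMeasurable.aemeasurable)
  have hfin : ∀ᵐ x, kineticDensity g (m x) (w x) < ⊤ := ae_lt_top' hmeas hP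
  set κ : Space N → ℝ := fun x => m x * (1 / g * ‖(m x)⁻¹ • w x‖ ^ g) with hκ
  have hκ0 : 0 ≤ᵐ[volume] κ := by
    filter_upwards [hm0] with x hx
    simp only [hκ, Pi.zero_apply]
    positivity
  have hκe : ∫⁻ x, kineticDensity g (m x) (w x) = ∫⁻ x, ENNReal.ofReal (κ x) := by
    refine lintegral_congr_ae ?_
    filter_upwards [hfin] with x hx
    exact (kineticDensity_of_ne_top hx.ne).1
  have hκm : AEStronglyMeasurable κ volume := by
    have h1 := hm.aestronglyMeasurable.aemeasurable
    have h2 := hw.aestronglyMeasurable.aemeasurable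
    exact AEMeasurable.aestronglyMeasurable (by fun_prop)
  have hκi : Integrable κ := by
    refine (lintegral_ofReal_ne_top_iff_integrable hκm hκ0).1 ?_
    rwa [← hκe]
  have hκI : ∫ x, κ x = (∫⁻ x, kineticDensity g (m x) (w x)).toReal := by
    rw [integral_eq_lintegral_of_nonneg_ae hκ0 hκm, hκe]
  rw [← hκI]
  set D := θ * g * (∫ x, κ x) + C * ε ^ (-(g * a / (g - a))) * M with hD
  have hδ : ∀ δ, 0 < δ → ∫⁻ x, ENNReal.ofReal (m x * (‖x - y‖ ^ 2 + δ ^ 2) ^ (-a / 2)) ≤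
      ENNReal.ofReal ((∫ x, (θ * g * κ x + C * ε ^ (-(g * a / (g - a))) * m x))) := by
    intro δ hδ
    obtain ⟨Φ, B, K, hΦ, hB, hK1, hK2, hpt⟩ := hdom ε δ hε hδ y
    have hwe := weak_equation_of_bounded hm hw H hΦ hK1 hK2
    have hi1 : Integrable fun x => m x * Laplacian.laplacian Φ x :=
      hm.mul_bdd (c := K) (continuous_laplacian hΦ).aestronglyMeasurable
        (Filter.Eventually.of_forall hK2)
    have hi2 : Integrable fun x => inner ℝ (w x) (gradient Φ x) := by
      refine (hw.norm.mul_const K).mono' (hw.aestronglyMeasurable.inner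
        (contDiff_gradient hΦ).continuous.aestronglyMeasurable)
        (Filter.Eventually.of_forall fun x => ?_)
      exact (abs_real_inner_le_norm _ _).trans
        (mul_le_mul_of_nonneg_left (hK1 x) (norm_nonneg _))
    have hi3 : Integrable fun x => θ * g * κ x + C * ε ^ (-(g * a / (g - a))) * m x :=
      (hκi.const_mul _).add (hm.const_mul _)
    have hi4 : Integrable fun x => B * (m x * Laplacian.laplacian Φ x) +
        B / ε * inner ℝ (w x) (gradient Φ x) := (hi1.const_mul _).add (hi2.const_mul _)
    -- This is the weak equation for `Φ` multiplied by B/ε: the terms involving the potential cancel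
    -- exactly, whatever `B` and `δ` are.
    have hzero : ∫ x, (B * (m x * Laplacian.laplacian Φ x) +
        B / ε * inner ℝ (w x) (gradient Φ x)) = 0 := by
      rw [integral_add (hi1.const_mul _) (hi2.const_mul _), integral_const_mul,
        integral_const_mul, ← hwe]
      simp only [mul_neg, integral_neg]
      field_simp
      ring
    -- The dominating inequality at l = |w|/m is multiplied by m, and Cauchy-Schwarz turns m l |∇Φ|
    -- into the inner product. Where m = 0, finite kinetic density forces w = 0, so m l = |w| still
    -- holds.
    have hle : ∀ᵐ x, m x * (‖x - y‖ ^ 2 + δ ^ 2) ^ (-a / 2) ≤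
        (B * (m x * Laplacian.laplacian Φ x) + B / ε * inner ℝ (w x) (gradient Φ x)) +
          (θ * g * κ x + C * ε ^ (-(g * a / (g - a))) * m x) := by
      filter_upwards [hm0, hfin] with x hx hf
      have h0 := (kineticDensity_of_ne_top hf.ne).2
      set l := ‖(m x)⁻¹ • w x‖ with hl
      have hml : m x * l = ‖w x‖ := by
        rcases hx.eq_or_lt with h | h
        · simp [h0 h.symm, hl]
        · rw [hl, norm_smul, norm_inv, Real.norm_of_nonneg hx, mul_inv_cancel_left₀ h.ne']
      have hp := mul_le_mul_of_nonneg_left (hpt x l (norm_nonneg _)) hx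
      have hin : -(‖w x‖ * ‖gradient Φ x‖) ≤ inner ℝ (w x) (gradient Φ x) :=
        (abs_le.1 (abs_real_inner_le_norm _ _)).1
      have hin' := mul_le_mul_of_nonneg_left hin (by positivity : 0 ≤ B / ε)
      have hκx : θ * g * κ x = m x * (θ * l ^ g) := by
        change θ * g * (m x * (1 / g * l ^ g)) = _
        field_simp
      have hr : m x * (B / ε * l * ‖gradient Φ x‖) = B / ε * (‖w x‖ * ‖gradient Φ x‖) := by
        rw [← hml]; ring
      rw [hκx]
      linarith
    have hnn : 0 ≤ᵐ[volume] fun x => (B * (m x * Laplacian.laplacian Φ x) +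
        B / ε * inner ℝ (w x) (gradient Φ x)) +
          (θ * g * κ x + C * ε ^ (-(g * a / (g - a))) * m x) := by
      filter_upwards [hm0, hle] with x hx hl
      exact le_trans (by positivity) hl
    calc _ ≤ ∫⁻ x, ENNReal.ofReal ((B * (m x * Laplacian.laplacian Φ x) +
          B / ε * inner ℝ (w x) (gradient Φ x)) +
          (θ * g * κ x + C * ε ^ (-(g * a / (g - a))) * m x)) := by
          refine lintegral_mono_ae ?_
          filter_upwards [hle] with x hx using ENNReal.ofReal_le_ofReal hx
      _ = ENNReal.ofReal (∫ x, ((B * (m x * Laplacian.laplacian Φ x) +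
          B / ε * inner ℝ (w x) (gradient Φ x)) +
          (θ * g * κ x + C * ε ^ (-(g * a / (g - a))) * m x))) :=
          (ofReal_integral_eq_lintegral_ofReal (hi4.add hi3) hnn).symm
      _ = _ := by rw [integral_add hi4 hi3, hzero, zero_add]
  have hDe : ∫ x, (θ * g * κ x + C * ε ^ (-(g * a / (g - a))) * m x) = D := by
    rw [integral_add (hκi.const_mul _) (hm.const_mul _), integral_const_mul, integral_const_mul,
      hM, hD]
  rw [hDe] at hδ
  set d : ℕ → ℝ := fun n => 1 / ((n : ℝ) + 1) with hd
  have hd0 : ∀ n, 0 < d n := fun n => by positivity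
  have hdt : Filter.Tendsto d Filter.atTop (𝓝 0) := tendsto_one_div_add_atTop_nhds_zero_nat
  calc ∫⁻ x, ENNReal.ofReal (m x / ‖x - y‖ ^ a)
      ≤ ∫⁻ x, Filter.liminf (fun n =>
          ENNReal.ofReal (m x * (‖x - y‖ ^ 2 + d n ^ 2) ^ (-a / 2))) Filter.atTop := by
        refine lintegral_mono fun x => ?_
        by_cases hxy : x = y
        -- At x = y the integrand on the left is a division by zero, hence 0.
        · simp [hxy, Real.zero_rpow ha.ne']
        · have hn : 0 < ‖x - y‖ := norm_pos_iff.2 (sub_ne_zero.2 hxy)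
          refine le_of_eq (Filter.Tendsto.liminf_eq ?_).symm
          refine ENNReal.tendsto_ofReal ?_
          rw [div_eq_mul_inv]
          refine Filter.Tendsto.const_mul _ ?_
          have h1 : (‖x - y‖ ^ a)⁻¹ = (‖x - y‖ ^ 2 + 0 ^ 2) ^ (-a / 2) := by
            rw [← Real.rpow_neg hn.le, zero_pow two_ne_zero, add_zero, ← Real.rpow_natCast,
              ← Real.rpow_mul hn.le]
            congr 1
            push_cast
            ring
          rw [h1]
          refine Filter.Tendsto.rpow_const ((hdt.pow 2).const_add _) (Or.inl ?_)
          positivity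
    _ ≤ Filter.liminf (fun n => ∫⁻ x,
          ENNReal.ofReal (m x * (‖x - y‖ ^ 2 + d n ^ 2) ^ (-a / 2))) Filter.atTop := by
        refine lintegral_liminf_le' fun n => ?_
        have h1 := hm.aestronglyMeasurable.aemeasurable
        fun_prop
    _ ≤ Filter.liminf (fun _ : ℕ => ENNReal.ofReal D) Filter.atTop :=
        Filter.liminf_le_liminf (Filter.Eventually.of_forall fun n => hδ (d n) (hd0 n))
    _ = ENNReal.ofReal D := by simp

/-- The Riesz interaction of an admissible pair is controlled by its kinetic energy. -/
theorem exists_rieszInteraction_bound {N : ℕ} {α g θ : ℝ} (hN : 1 ≤ N) (hα0 : 0 < α)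
    (hαN : α < N) (hg : 1 < g) (hag : (N : ℝ) - α < g) (hθ : 0 < θ) :
    ∃ C, 0 < C ∧ ∀ (ε M : ℝ) (m : Space N → ℝ) (w : Space N → Space N), 0 < ε →
      (m, w) ∈ constraintSet N g ε M → ∫⁻ x, kineticDensity g (m x) (w x) ≠ ⊤ →
        rieszInteraction α m ≤ ENNReal.ofReal
          (M * (θ * g * (∫⁻ x, kineticDensity g (m x) (w x)).toReal +
            C * ε ^ (-(g * (N - α) / (g - (N - α)))) * M)) := by
  obtain ⟨C, hC, hb⟩ := exists_rieszPotential_bound (N := N) (a := N - α) hN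
    (by linarith) (by linarith) hg hag hθ
  refine ⟨C, hC, fun ε M m w hε hmw hP => ?_⟩
  have hb' := hb ε M m w hε hmw hP
  obtain ⟨hm1, -, hw1, hM, hm0, H⟩ := hmw
  simp only at hm1 hM hm0
  have hm : Integrable m := memLp_one_iff_integrable.1 hm1
  have hM0 : 0 ≤ M := hM ▸ integral_nonneg_of_ae hm0
  rw [ENNReal.ofReal_mul hM0]
  set D := ENNReal.ofReal (θ * g * (∫⁻ x, kineticDensity g (m x) (w x)).toReal +
    C * ε ^ (-(g * (N - α) / (g - (N - α)))) * M)
  unfold rieszInteraction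
  calc _ ≤ ∫⁻ x, ENNReal.ofReal (m x) * D := by
        refine lintegral_mono_ae ?_
        filter_upwards [hm0] with x hx
        calc _ = ∫⁻ y, ENNReal.ofReal (m x) * ENNReal.ofReal (m y / ‖y - x‖ ^ ((N : ℝ) - α)) := by
              refine lintegral_congr fun y => ?_
              rw [← ENNReal.ofReal_mul hx, norm_sub_rev, mul_div_assoc]
          _ = ENNReal.ofReal (m x) * ∫⁻ y, ENNReal.ofReal (m y / ‖y - x‖ ^ ((N : ℝ) - α)) :=
              lintegral_const_mul' _ _ ENNReal.ofReal_ne_top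
          _ ≤ _ := by gcongr; exact hb' x
    _ = ENNReal.ofReal M * D := by
        rw [lintegral_mul_const' _ _ ENNReal.ofReal_ne_top,
          ← ofReal_integral_eq_lintegral_ofReal hm hm0, hM]

/-- Lower bound for the energy, uniform in the potential. -/
theorem exists_energy_lower_bound {N : ℕ} {α g M : ℝ} (hN : 1 ≤ N) (hα0 : 0 < α)
    (hαN : α < N) (hg : 1 < g) (hag : (N : ℝ) - α < g) (hM : 0 < M) :
    ∃ C, 0 < C ∧ ∀ (ε : ℝ) (V : Space N → ℝ), 0 < ε →
      ((-C * ε ^ (-(g * ((N : ℝ) - α) / (g - N + α))) : ℝ) : EReal) ≤ infEnergy g α ε M V := by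
  -- This θ gives M θ g = 2, so half the interaction is at most the kinetic energy plus C M² E / 2.
  obtain ⟨C, hC, hb⟩ := exists_rieszInteraction_bound (N := N) hN hα0 hαN hg hag
    (θ := 2 / (M * g)) (by positivity)
  refine ⟨C * M ^ 2 / 2, by positivity, fun ε V hε => ?_⟩
  refine le_iInf₂ fun p hp => ?_
  obtain ⟨m, w⟩ := p
  unfold energy
  rw [if_pos hp]
  split_ifs with htop
  · exact le_top
  have hkp : ∫⁻ x, kineticDensity g (m x) (w x) ≤ positivePart g V m w :=
    lintegral_mono fun x => le_self_add
  have hk : ∫⁻ x, kineticDensity g (m x) (w x) ≠ ⊤ := ne_top_of_le_ne_top htop hkp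
  have hR := hb ε M m w hε hp hk
  set P := (∫⁻ x, kineticDensity g (m x) (w x)).toReal with hP
  have hPle : P ≤ (positivePart g V m w).toReal := ENNReal.toReal_mono htop hkp
  rw [show g - (N - α) = g - N + α by ring] at hR
  set E := ε ^ (-(g * ((N : ℝ) - α) / (g - N + α))) with hE
  have hE0 : 0 < E := by positivity
  have hP0 : 0 ≤ P := ENNReal.toReal_nonneg
  have hval : M * (2 / (M * g) * g * P + C * E * M) = 2 * P + C * M ^ 2 * E := by
    field_simp
  rw [hval] at hR
  have hRtop : rieszInteraction α m ≠ ⊤ := ne_top_of_le_ne_top ENNReal.ofReal_ne_top hR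
  have hRr : (rieszInteraction α m).toReal ≤ 2 * P + C * M ^ 2 * E := by
    refine (ENNReal.toReal_mono ENNReal.ofReal_ne_top hR).trans_eq ?_
    exact ENNReal.toReal_ofReal (by positivity)
  have hR2 : rieszInteraction α m / 2 ≠ ⊤ := ENNReal.div_ne_top hRtop two_ne_zero
  rw [← ENNReal.ofReal_toReal htop, ← ENNReal.ofReal_toReal hR2,
    EReal.coe_ennreal_ofReal, EReal.coe_ennreal_ofReal,
    max_eq_left ENNReal.toReal_nonneg, max_eq_left ENNReal.toReal_nonneg, ← EReal.coe_sub,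
    EReal.coe_le_coe_iff, ENNReal.toReal_div]
  simp only [ENNReal.toReal_ofNat]
  linarith

/-! ### Upper bound: concentrated competitors -/

theorem fderiv_apply_single_eq_gradient {N : ℕ} {f : Space N → ℝ} (hf : ContDiff ℝ ∞ f)
    (x : Space N) (i : Fin N) :
    fderiv ℝ f x (EuclideanSpace.single i 1) = gradient f x i := by
  rw [(hasGradientAt_of_contDiff hf x).fderiv_apply, EuclideanSpace.inner_single_right]
  simp

theorem hasCompactSupport_gradient {N : ℕ} {f : Space N → ℝ} (hc : HasCompactSupport f) :
    HasCompactSupport (gradient f) :=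
  (hc.fderiv (𝕜 := ℝ)).comp_left (g := (InnerProductSpace.toDual ℝ (Space N)).symm) (by simp)

/-- Green's identity for a compactly supported smooth function. -/
theorem integral_mul_neg_laplacian {N : ℕ} {m φ : Space N → ℝ} (hm : ContDiff ℝ ∞ m)
    (hmc : HasCompactSupport m) (hφ : ContDiff ℝ ∞ φ) :
    ∫ x, m x * (-(Laplacian.laplacian φ x)) = ∫ x, inner ℝ (gradient m x) (gradient φ x) := by
  have hgφ := contDiff_gradient hφ
  have hgm := contDiff_gradient hm
  have hcoord : ∀ i, ContDiff ℝ ∞ fun x => gradient φ x i := fun i =>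
    (EuclideanSpace.proj (𝕜 := ℝ) i).contDiff.comp hgφ
  have hcoordm : ∀ i, ContDiff ℝ ∞ fun x => gradient m x i := fun i =>
    (EuclideanSpace.proj (𝕜 := ℝ) i).contDiff.comp hgm
  have hcm : ∀ i, HasCompactSupport fun x => gradient m x i := fun i =>
    (hasCompactSupport_gradient hmc).comp_left (g := fun v : Space N => v i) rfl
  have hd : ∀ i x, fderiv ℝ (fun x => gradient φ x i) x (EuclideanSpace.single i 1) =
      (fderiv ℝ (gradient φ) x (EuclideanSpace.single i 1)) i := by
    intro i x
    have := ((EuclideanSpace.proj (𝕜 := ℝ) i).hasFDerivAt.comp x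
      (hgφ.differentiable (by simp) x).hasFDerivAt).fderiv
    exact congrArg (fun L => L (EuclideanSpace.single i 1)) this
  have hcd : ∀ i, Continuous fun x =>
      fderiv ℝ (fun x => gradient φ x i) x (EuclideanSpace.single i 1) := fun i =>
    ((hcoord i).continuous_fderiv (by simp)).clm_apply continuous_const
  have hI1 : ∀ i, Integrable fun x =>
      m x * fderiv ℝ (fun x => gradient φ x i) x (EuclideanSpace.single i 1) := fun i =>
    (hm.continuous.mul (hcd i)).integrable_of_hasCompactSupport hmc.mul_right
  have hI2 : ∀ i, Integrable fun x => gradient m x i * gradient φ x i := fun i =>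
    ((hcoordm i).continuous.mul (hcoord i).continuous).integrable_of_hasCompactSupport
      (hcm i).mul_right
  have hparts : ∀ i, ∫ x, m x * fderiv ℝ (fun x => gradient φ x i) x (EuclideanSpace.single i 1) =
      -∫ x, gradient m x i * gradient φ x i := by
    intro i
    rw [integral_mul_fderiv_eq_neg_fderiv_mul_of_integrable]
    · simp only [fderiv_apply_single_eq_gradient hm]
    · simpa only [fderiv_apply_single_eq_gradient hm] using hI2 i
    · exact hI1 i
    · exact (hm.continuous.mul (hcoord i).continuous).integrable_of_hasCompactSupport hmc.mul_right
    · exact fun x _ => hm.differentiable (by simp) x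
    · exact fun x _ => (hcoord i).differentiable (by simp) x
  calc ∫ x, m x * (-(Laplacian.laplacian φ x))
      = -∫ x, ∑ i, m x * fderiv ℝ (fun x => gradient φ x i) x (EuclideanSpace.single i 1) := by
        rw [← integral_neg]
        refine integral_congr_ae (Filter.Eventually.of_forall fun x => ?_)
        simp only [laplacian_eq_sum_fderiv_gradient hφ, hd, Finset.mul_sum, mul_neg]
    _ = ∑ i, ∫ x, gradient m x i * gradient φ x i := by
        rw [integral_finsetSum _ fun i _ => hI1 i]
        simp only [hparts, Finset.sum_neg_distrib, neg_neg]
    _ = ∫ x, ∑ i, gradient m x i * gradient φ x i :=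
        (integral_finsetSum _ fun i _ => hI2 i).symm
    _ = _ := by
        refine integral_congr_ae (Filter.Eventually.of_forall fun x => ?_)
        simp only [PiLp.inner_apply]
        exact Finset.sum_congr rfl fun i _ => by simp [mul_comm]

/-- For the flux ε∇m the constraint is Green's identity, and a continuous compactly supported
density lies in every L^p. -/
theorem mem_constraintSet_of_contDiff {N : ℕ} {g ε M : ℝ} {m : Space N → ℝ}
    (hm : ContDiff ℝ ∞ m) (hmc : HasCompactSupport m) (hm0 : ∀ x, 0 ≤ m x) (hM : ∫ x, m x = M) :
    (m, fun x => ε • gradient m x) ∈ constraintSet N g ε M := by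
  refine ⟨hm.continuous.memLp_of_hasCompactSupport hmc,
    hm.continuous.memLp_of_hasCompactSupport hmc,
    ((contDiff_gradient hm).continuous.const_smul ε).memLp_of_hasCompactSupport
      ((hasCompactSupport_gradient hmc).smul_left (f := fun _ => ε)), hM,
    Filter.Eventually.of_forall hm0, fun φ hφ _ => ?_⟩
  simp only [inner_smul_left, conj_trivial]
  rw [integral_const_mul, integral_mul_neg_laplacian hm hmc hφ]

/-- Interaction of a density supported in a small ball. -/
theorem le_rieszInteraction_of_support {N : ℕ} {α M r : ℝ} {m : Space N → ℝ} (hN : 1 ≤ N)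
    (hαN : α < N) (hr : 0 < r) (hm : Integrable m) (hm0 : ∀ x, 0 ≤ m x)
    (hM : ∫ x, m x = M) (hsupp : ∀ x, r < ‖x‖ → m x = 0) :
    ENNReal.ofReal ((2 * r) ^ (-((N : ℝ) - α)) * M ^ 2) ≤ rieszInteraction α m := by
  have : Nonempty (Fin N) := ⟨⟨0, hN⟩⟩
  have ha : 0 ≤ (N : ℝ) - α := by linarith
  set k := (2 * r) ^ (-((N : ℝ) - α)) with hk
  have hk0 : 0 < k := by positivity
  have hM0 : 0 ≤ M := hM ▸ integral_nonneg hm0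
  have hlm : ∫⁻ x, ENNReal.ofReal (m x) = ENNReal.ofReal M := by
    rw [← hM, ofReal_integral_eq_lintegral_ofReal hm (Filter.Eventually.of_forall hm0)]
  unfold rieszInteraction
  calc ENNReal.ofReal (k * M ^ 2)
      = ∫⁻ x, ENNReal.ofReal (m x) * (ENNReal.ofReal k * ENNReal.ofReal M) := by
        rw [lintegral_mul_const' _ _ (by finiteness), hlm, ENNReal.ofReal_mul hk0.le, sq,
          ENNReal.ofReal_mul hM0]
        ring
    _ ≤ _ := by
        refine lintegral_mono fun x => ?_
        calc _ = ∫⁻ y, ENNReal.ofReal (m x) * ENNReal.ofReal k * ENNReal.ofReal (m y) := by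
              rw [lintegral_const_mul' _ _ (by finiteness), hlm, mul_assoc]
          _ ≤ _ := by
              refine lintegral_mono_ae ?_
              -- On the diagonal division by zero makes the integrand 0, so the lower bound can fail
              -- there; a point is null because N ≥ 1.
              filter_upwards [(Measure.ae_ne volume x)] with y hy
              rw [← ENNReal.ofReal_mul (hm0 x), ← ENNReal.ofReal_mul (by have := hm0 x; positivity)]
              refine ENNReal.ofReal_le_ofReal ?_
              have hnn := mul_nonneg (hm0 x) (hm0 y)
              by_cases hx : r < ‖x‖
              · simp [hsupp x hx]
              by_cases hy' : r < ‖y‖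
              · simp [hsupp y hy']
              have hxy : 0 < ‖x - y‖ := norm_pos_iff.2 (sub_ne_zero.2 (Ne.symm hy))
              have hle : ‖x - y‖ ≤ 2 * r := (norm_sub_le x y).trans (by linarith)
              have h1 : k ≤ (‖x - y‖ ^ ((N : ℝ) - α))⁻¹ := by
                rw [← Real.rpow_neg hxy.le]
                exact Real.rpow_le_rpow_of_nonpos hxy hle (by linarith)
              rw [div_eq_mul_inv]
              calc m x * k * m y = m x * m y * k := by ring
                _ ≤ _ := mul_le_mul_of_nonneg_left h1 hnn

open scoped Pointwise in
/-- Smooth densities of mass `M` concentrated at scale `1 / τ`, with kinetic energy of order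
`(ε τ) ^ g` when paired with `ε ∇m`. -/
theorem exists_concentrated_density {N : ℕ} {g M : ℝ} (hg : 1 < g) (hM : 0 < M) :
    ∃ A, 0 < A ∧ ∀ τ ε : ℝ, 0 < τ → 0 < ε → ∃ m : Space N → ℝ, ContDiff ℝ ∞ m ∧
      HasCompactSupport m ∧ (∀ x, 0 ≤ m x) ∧ ∫ x, m x = M ∧ (∀ x, 2 / τ < ‖x‖ → m x = 0) ∧
      ∫⁻ x, kineticDensity g (m x) (ε • gradient m x) ≤ ENNReal.ofReal (A * (ε * τ) ^ g) := by
  obtain ⟨η, hη, hη01, hη1, hη0, C, hC, hηC⟩ := exists_cutoff N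
  have hg0 : 0 < g := by linarith
  -- For ρ = η^(k+1) the ratio |∇ρ|/ρ is of order 1/η, so ρ(|∇ρ|/ρ)^g is of order η^(k+1-g), bounded
  -- up to the zero set because k ≥ g. As k > 0, the flux also vanishes wherever η does.
  obtain ⟨k, hk⟩ := exists_nat_ge g
  set ρ : Space N → ℝ := fun x => η x ^ (k + 1) with hρ
  have hρs : ContDiff ℝ ∞ ρ := hη.pow (k + 1)
  have hρ0 : ∀ x, 0 ≤ ρ x := fun x => pow_nonneg (hη01 x).1 _
  have hρsupp : ∀ x, 2 < ‖x‖ → ρ x = 0 := fun x hx => by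
    simp [hρ, (hη0 x hx).self_of_nhds]
  have hρc : HasCompactSupport ρ :=
    HasCompactSupport.intro (isCompact_closedBall (0 : Space N) 2) fun x hx => by
      exact hρsupp x (by simpa using hx)
  set I := ∫ x, ρ x with hI
  have hI0 : 0 < I := by
    refine hρs.continuous.integral_pos_of_hasCompactSupport_nonneg_nonzero hρc hρ0 (x := 0) ?_
    simp [hρ, (hη1 0 (by simp)).self_of_nhds]
  set v := (volume (Metric.closedBall (0 : Space N) 2)).toReal with hv
  have hgη : ∀ x, HasGradientAt ρ (((k + 1 : ℕ) * η x ^ k) • gradient η x) x := by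
    intro x
    have := (hasGradientAt_of_contDiff hη x).hasFDerivAt.pow (k + 1)
    rw [hasGradientAt_iff_hasFDerivAt]
    refine this.congr_fderiv ?_
    ext u
    simp
  set A0 := 1 / g * ((k + 1 : ℕ) * C) ^ g * (M / I) * v with hA0
  have hA0' : 0 ≤ A0 := by positivity
  refine ⟨A0 + 1, by positivity, fun τ ε hτ hε => ?_⟩
  set c := M / I * τ ^ N with hc
  have hc0 : 0 < c := by positivity
  have hcs : ContDiff ℝ ∞ fun x : Space N => ρ (τ • x) := hρs.comp (contDiff_const_smul τ)
  have hnorm : ∀ x : Space N, 2 / τ < ‖x‖ → 2 < ‖τ • x‖ := fun x hx => by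
    rw [div_lt_iff₀ hτ] at hx
    rw [norm_smul, Real.norm_of_nonneg hτ.le]; linarith
  have hscale : ∀ f : Space N → ℝ, ∫ x, f (τ • x) = (τ ^ N)⁻¹ * ∫ x, f x := fun f => by
    rw [Measure.integral_comp_smul_of_nonneg volume f τ (hR := hτ.le)]
    simp
  have hsupp : ∀ x, 2 / τ < ‖x‖ → c * ρ (τ • x) = 0 := fun x hx => by
    rw [hρsupp _ (hnorm x hx), mul_zero]
  have hgrad : ∀ x, gradient (fun x => c * ρ (τ • x)) x =
      c • τ • ((k + 1 : ℕ) * η (τ • x) ^ k) • gradient η (τ • x) := by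
    intro x
    have h1 := hasGradientAt_comp_smul hρs τ x
    rw [(hgη (τ • x)).gradient] at h1
    have h2 := hasGradientAt_mul (hasGradientAt_const (𝕜 := ℝ) x c) h1
    simpa using h2.gradient
  refine ⟨fun x => c * ρ (τ • x), contDiff_const.mul hcs, ?_,
    fun x => mul_nonneg hc0.le (hρ0 _), ?_, hsupp, ?_⟩
  · exact HasCompactSupport.intro (isCompact_closedBall (0 : Space N) (2 / τ)) fun x hx =>
      hsupp x (by simpa using hx)
  · rw [integral_const_mul, hscale, ← hI, hc]
    field_simp
  -- `B` bounds the kinetic density on the ball of radius 2/τ; the volume τ^(-N) v of that ball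
  -- cancels the τ^N contained in `c`.
  · set B := 1 / g * (ε * τ * ((k + 1 : ℕ) * C)) ^ g * c with hB
    have hB0 : 0 ≤ B := by positivity
    have hpt : ∀ x, kineticDensity g (c * ρ (τ • x)) (ε • gradient (fun x => c * ρ (τ • x)) x) ≤
        (Metric.closedBall (0 : Space N) (2 / τ)).indicator (fun _ => ENNReal.ofReal B) x := by
      intro x
      unfold kineticDensity
      rcases (hη01 (τ • x)).1.eq_or_lt with h0 | hpos
      · have hz : c * ρ (τ • x) = 0 := by simp [hρ, ← h0]
        have hw : ε • gradient (fun x => c * ρ (τ • x)) x = 0 := by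
          have hk0 : k ≠ 0 := by
            rintro rfl
            simp at hk
            linarith
          rw [hgrad, ← h0, zero_pow hk0]
          simp
        rw [if_neg (by rw [hz]; exact lt_irrefl _), if_pos ⟨hz, hw⟩]
        exact zero_le
      · have hmp : 0 < c * ρ (τ • x) := by positivity
        have hmem : x ∈ Metric.closedBall (0 : Space N) (2 / τ) := by
          by_contra hx
          exact hmp.ne' (hsupp x (by simpa using hx))
        rw [if_pos hmp, Set.indicator_of_mem hmem]
        refine ENNReal.ofReal_le_ofReal ?_
        have hle : ‖(c * ρ (τ • x))⁻¹ • ε • gradient (fun x => c * ρ (τ • x)) x‖ ≤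
            ε * τ * ((k + 1 : ℕ) * C) * (η (τ • x))⁻¹ := by
          rw [hgrad]
          simp only [norm_smul, norm_inv, norm_mul, Real.norm_of_nonneg hmp.le,
            Real.norm_of_nonneg hε.le, Real.norm_of_nonneg hc0.le, Real.norm_of_nonneg hτ.le,
            norm_pow, Real.norm_of_nonneg hpos.le, Real.norm_natCast]
          simp only [hρ]
          calc _ = ε * τ * ((k + 1 : ℕ) * ‖gradient η (τ • x)‖) * (η (τ • x))⁻¹ := by
                field_simp
                ring
            _ ≤ _ := by
                gcongr
                exact (hηC _).1
        have h1 := Real.rpow_le_rpow (norm_nonneg _) hle hg0.le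
        rw [Real.mul_rpow (by positivity) (by positivity), Real.inv_rpow hpos.le] at h1
        have h2 : ρ (τ • x) * (η (τ • x) ^ g)⁻¹ ≤ 1 := by
          rw [← div_eq_mul_inv, div_le_one (by positivity)]
          simp only [hρ]
          rw [← Real.rpow_natCast]
          refine Real.rpow_le_rpow_of_exponent_ge hpos (hη01 _).2 ?_
          push_cast
          linarith
        calc _ ≤ c * ρ (τ • x) * (1 / g * ((ε * τ * ((k + 1 : ℕ) * C)) ^ g *
              (η (τ • x) ^ g)⁻¹)) := by gcongr
          _ = B * (ρ (τ • x) * (η (τ • x) ^ g)⁻¹) := by rw [hB]; ring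
          _ ≤ B * 1 := mul_le_mul_of_nonneg_left h2 hB0
          _ = B := mul_one B
    have hvol : volume (Metric.closedBall (0 : Space N) (2 / τ)) =
        ENNReal.ofReal ((τ ^ N)⁻¹ * v) := by
      have h1 : Metric.closedBall (0 : Space N) (2 / τ) =
          τ⁻¹ • Metric.closedBall (0 : Space N) 2 := by
        rw [smul_closedBall' (inv_ne_zero hτ.ne'), smul_zero,
          Real.norm_of_nonneg (inv_nonneg.2 hτ.le)]
        congr 1
        ring
      rw [h1, Measure.addHaar_smul, ENNReal.ofReal_mul (by positivity), hv,
        ENNReal.ofReal_toReal (isCompact_closedBall _ _).measure_lt_top.ne]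
      simp [abs_of_pos hτ]
    calc _ ≤ _ := lintegral_mono hpt
      _ = ENNReal.ofReal (B * ((τ ^ N)⁻¹ * v)) := by
        rw [lintegral_indicator_const Metric.isClosed_closedBall.measurableSet, hvol,
          ENNReal.ofReal_mul hB0]
      _ ≤ _ := by
        refine ENNReal.ofReal_le_ofReal ?_
        have h1 : B * ((τ ^ N)⁻¹ * v) = A0 * (ε * τ) ^ g := by
          rw [hB, hA0, hc, Real.mul_rpow (by positivity) (by positivity)]
          field_simp
        rw [h1]
        gcongr
        linarith

/-- Upper bound for the infimum of the energy by a concentrated competitor. -/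
theorem exists_infEnergy_upper_bound {N : ℕ} {α g M : ℝ} (hN : 1 ≤ N)
    (hαN : α < N) (hg : 1 < g) (hag : (N : ℝ) - α < g) (hM : 0 < M) :
    ∃ C κ, 0 < C ∧ 0 < κ ∧ ∀ CV b : ℝ, 0 < CV → 0 < b → ∀ V : Space N → ℝ,
      PotentialGrowth CV b V → ∀ ε : ℝ, 0 < ε → ε ≤ 1 →
        infEnergy g α ε M V ≤ ((-C * ε ^ (-(g * ((N : ℝ) - α) / (g - N + α))) +
          CV * (1 + 2 / κ) ^ b * M : ℝ) : EReal) := by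
  obtain ⟨A, hA, hdens⟩ := exists_concentrated_density (N := N) hg hM
  have hg0 : 0 < g := by linarith
  have hga : 0 < g - (N - α) := by linarith
  set a : ℝ := N - α with ha
  have ha0 : 0 < a := by linarith
  -- The interaction of a density supported in radius 2/τ is at least 4q τ^a. Halved, it gives 2qκ^a
  -- S, against a kinetic energy A κ^g S = qκ^a S by the choice of `κ`; the net gain is qκ^a S.
  set q := 4 ^ (-a) * M ^ 2 / 4 with hq
  have hq0 : 0 < q := by positivity
  set κ := (q / A) ^ (1 / (g - a)) with hκ
  have hκ0 : 0 < κ := by positivity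
  have hκg : A * κ ^ g = q * κ ^ a := by
    have h1 : κ ^ g = κ ^ (g - a) * κ ^ a := by rw [← Real.rpow_add hκ0, sub_add_cancel]
    have h2 : κ ^ (g - a) = q / A := by
      rw [hκ, ← Real.rpow_mul (by positivity), one_div_mul_cancel hga.ne', Real.rpow_one]
    rw [h1, h2]
    field_simp
  refine ⟨q * κ ^ a, κ, by positivity, hκ0, fun CV b hCV hb V hV ε hε hε1 => ?_⟩
  rw [show g - N + α = g - a by rw [ha]; ring]
  set S := ε ^ (-(g * a / (g - a))) with hS
  set τ := κ * ε ^ (-(g / (g - a))) with hτ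
  have hτ0 : 0 < τ := by positivity
  -- This is where ε ≤ 1 enters: the support stays in the ball of radius 2/κ, so the cost of V is
  -- bounded independently of ε.
  have hτκ : κ ≤ τ := by
    refine le_mul_of_one_le_right hκ0.le ?_
    refine Real.one_le_rpow_of_pos_of_le_one_of_nonpos hε hε1 ?_
    rw [neg_nonpos]
    positivity
  have hτa : τ ^ a = κ ^ a * S := by
    rw [hτ, hS, Real.mul_rpow hκ0.le (by positivity), ← Real.rpow_mul hε.le]
    congr 2
    ring
  have hετ : (ε * τ) ^ g = κ ^ g * S := by
    have h1 : ε * τ = κ * ε ^ (-(a / (g - a))) := by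
      calc ε * τ = κ * (ε ^ (1 : ℝ) * ε ^ (-(g / (g - a)))) := by rw [hτ, Real.rpow_one]; ring
        _ = _ := by
          rw [← Real.rpow_add hε]
          congr 2
          field_simp
          ring
    rw [h1, hS, Real.mul_rpow hκ0.le (by positivity), ← Real.rpow_mul hε.le]
    congr 2
    ring
  obtain ⟨m, hms, hmc, hm0, hmM, hmsupp, hkin⟩ := hdens τ ε hτ0 hε
  have hmi : Integrable m := hms.continuous.integrable_of_hasCompactSupport hmc
  have hmem : (m, fun x => ε • gradient m x) ∈ constraintSet N g ε M :=
    mem_constraintSet_of_contDiff hms hmc hm0 hmM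
  set K := CV * (1 + 2 / κ) ^ b with hK
  have hK0 : 0 ≤ K := by positivity
  have hVm : ∫⁻ x, ENNReal.ofReal (V x * m x) ≤ ENNReal.ofReal (K * M) := by
    calc _ ≤ ∫⁻ x, ENNReal.ofReal (K * m x) := by
          refine lintegral_mono fun x => ENNReal.ofReal_le_ofReal ?_
          by_cases hx : 2 / τ < ‖x‖
          · simp [hmsupp x hx]
          · refine mul_le_mul_of_nonneg_right ((hV x).2.trans ?_) (hm0 x)
            refine mul_le_mul_of_nonneg_left (Real.rpow_le_rpow (by positivity) ?_ hb.le) hCV.le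
            have : 2 / τ ≤ 2 / κ := by gcongr
            linarith
      _ = ENNReal.ofReal (K * M) := by
          rw [← ofReal_integral_eq_lintegral_ofReal (hmi.const_mul K)
            (Filter.Eventually.of_forall fun x => mul_nonneg hK0 (hm0 x)), integral_const_mul, hmM]
  have hpos : positivePart g V m (fun x => ε • gradient m x) ≤
      ENNReal.ofReal (A * (ε * τ) ^ g + K * M) := by
    unfold positivePart
    rw [lintegral_add_left, ENNReal.ofReal_add (by positivity) (by positivity)]
    · exact add_le_add hkin hVm
    · exact (measurable_kineticDensity N g).comp (hms.continuous.measurable.prodMk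
        ((contDiff_gradient hms).continuous.const_smul ε).measurable)
  have hriesz := le_rieszInteraction_of_support (r := 2 / τ) hN hαN (by positivity) hmi hm0 hmM
    hmsupp
  have hrv : (2 * (2 / τ)) ^ (-((N : ℝ) - α)) * M ^ 2 = 4 * q * (κ ^ a * S) := by
    rw [← ha, ← hτa, hq, show 2 * (2 / τ) = 4 * τ⁻¹ by ring,
      Real.mul_rpow (by norm_num) (by positivity), Real.inv_rpow hτ0.le, Real.rpow_neg hτ0.le,
      inv_inv]
    ring
  rw [hrv] at hriesz
  refine (iInf₂_le (m, fun x => ε • gradient m x) hmem).trans ?_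
  unfold energy
  rw [if_pos hmem, if_neg (ne_top_of_le_ne_top ENNReal.ofReal_ne_top hpos)]
  have hS0 : 0 < S := by positivity
  have h1 : ENNReal.ofReal (2 * q * (κ ^ a * S)) ≤ rieszInteraction α m / 2 := by
    rw [ENNReal.le_div_iff_mul_le (Or.inl two_ne_zero) (Or.inl ENNReal.ofNat_ne_top)]
    refine le_trans (le_of_eq ?_) hriesz
    rw [← ENNReal.ofReal_ofNat 2, ← ENNReal.ofReal_mul (by positivity)]
    congr 1
    ring
  refine (EReal.sub_le_sub (EReal.coe_ennreal_le_coe_ennreal_iff.2 hpos)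
    (EReal.coe_ennreal_le_coe_ennreal_iff.2 h1)).trans ?_
  rw [EReal.coe_ennreal_ofReal, EReal.coe_ennreal_ofReal, max_eq_left (by positivity),
    max_eq_left (by positivity), ← EReal.coe_sub, EReal.coe_le_coe_iff, hετ, ← mul_assoc, hκg]
  linarith

end MFG

theorem lemma3p1 (N : ℕ) (γ γ' α M : ℝ) (hγ : 1 < γ) (hγ' : γ' = γ / (γ - 1))
    (hα0 : 0 < α) (hα : (N : ℝ) - γ' < α) (hαN : α < N) (hM : 0 < M) :
    ∃ C₁ C₂ : ℝ, 0 < C₁ ∧ 0 < C₂ ∧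
      ∀ CV b : ℝ, 0 < CV → 0 < b →
        ∃ K : ℝ, 0 < K ∧
          ∀ V : MFG.Space N → ℝ, MFG.LocallyHolder V → MFG.PotentialGrowth CV b V →
            ∀ ε : ℝ, 0 < ε → ε ≤ 1 →
              ((-C₁ * ε ^ (-(γ' * ((N : ℝ) - α) / (γ' - N + α))) : ℝ) : EReal)
                  ≤ MFG.infEnergy γ' α ε M V ∧
              MFG.infEnergy γ' α ε M V
                  ≤ ((-C₂ * ε ^ (-(γ' * ((N : ℝ) - α) / (γ' - N + α))) + K : ℝ) : EReal) := by
  have hg : 1 < γ' := by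
    rw [hγ', one_lt_div (by linarith)]
    linarith
  have hN : 1 ≤ N := by
    have : (0 : ℝ) < N := hα0.trans hαN
    exact_mod_cast this
  obtain ⟨C₁, hC₁, hlow⟩ :=
    MFG.exists_energy_lower_bound hN hα0 hαN hg (by linarith : (N : ℝ) - α < γ') hM
  obtain ⟨C₂, κ, hC₂, hκ, hup⟩ :=
    MFG.exists_infEnergy_upper_bound hN hαN hg (by linarith : (N : ℝ) - α < γ') hM
  -- `κ` was obtained before `CV` and `b`, so these enter `K` only through the displayed factors.
  refine ⟨C₁, C₂, hC₁, hC₂, fun CV b hCV hb =>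
    ⟨CV * (1 + 2 / κ) ^ b * M, by positivity, fun V _ hV ε hε hε1 => ⟨hlow ε V hε, ?_⟩⟩⟩
  exact hup CV b hCV hb V hV ε hε hε1
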